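/- **Setting.** Let $q=t^{1/4}$ and $v$ be nonzero complex numbers and put $u=qv+q^{-1}v^{-1}$. Let $\mathcal S$ be the ($\mathbb C$-linear) skein category of the annulus. Its objects are $n=0,1,2,\dots$; $\mathrm{Hom}_{\mathcal S}(m,n)$ is the complex vector space spanned by the planar isotopy classes of tangle diagrams in the annulus with $m$ marked points on the inner and $n$ marked points on the outer boundary circle (numbered counterclockwise from a fixed ray), modulo the Kauffman skein relation (a crossing equals $q$ times one of its smoothings plus $q^{-1}$ times the other one; a crossing of two neighbouring radial strands in which the strand that moves counterclockwise towards the outside is on top equals $q\,\mathrm{Id}+q^{-1}e$, where $e$ is the cap–cup diagram) and the removal of contractible loops with the factor $-(q^2+q^{-2})$. Composition $D\circ D'$ puts $D'$ inside $D$. Let $\mathrm{TL}_n=\mathrm{End}_{\mathcal S}(n)$, the $n$-th (extended) affine Temperley–Lieb algebra; $\mathrm{TL}_0=\mathbb C[X]$ with $X$ the non-contractible loop, and $\mathrm{TL}_1=\mathbb C[\rho^{\pm1}]$ with $\rho$ the Dehn twist of a radial strand. For diagrams $D\colon k\to l$ and $D'\colon m\to n$ let $D\times D'\colon k+m\to l+n$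 be the class of the diagram that is obtained by placing $D$ on top of $D'$, with the marked points of $D$ first. This gives algebra maps $\epsilon_{m,n}\colon \mathrm{TL}_m\otimes \mathrm{TL}_n\to \mathrm{TL}_{m+n}$, $Y\otimes Z\mapsto Y\times Z$, and the arc insertion maps $\mathcal I(Y)=Y\times \mathrm{Id}_1$; write $\mathcal I_n\colon\mathrm{TL}_n\to\mathrm{TL}_{n+1}$ for the latter on $\mathrm{TL}_n$. For an algebra map $\eta\colon A\to B$ and a left $A$-module $M$ let $\mathrm{Ind}^\eta(M)=B\otimes_A M$. The fusion product of a $\mathrm{TL}_n$-module $M_1$ and a $\mathrm{TL}_m$-module $M_2$ is the $\mathrm{TL}_{n+m}$-module $M_1\mathbin{\widehat\times_f}M_2=\mathrm{Ind}^{\epsilon_{n,m}}(M_1\otimes M_2)$. The link pattern modules are $V_{2k}(u)=\mathrm{Hom}_{\mathcal S}(0,2k)\otimes_{\mathrm{TL}_0}\mathbb C$, where $X$ acts on $\mathbb C$ as $u$, and $V_{2k+1}(v)=\mathrm{Hom}_{\mathcal S}(1,2k+1)\otimes_{\mathrm{TL}_1}\mathbb C$, where $\rho$ acts on $\mathbb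 C$ as $v$; write $Y_u=Y\otimes 1$ and $Z_v=Z\otimes 1$ for the classes of $Y$ and $Z$, and $1_v=(\mathrm{Id}_1)_v\in V_1(v)$. Let $c_+\in\mathrm{Hom}_{\mathcal S}(0,2)$ be the cup that does not meet the ray, $c_-$ its image under the rotation by one step, and $U=q\,c_++v\,c_-$. The link pattern tower $$V_0(u)\xrightarrow{\phi_0}V_1(v)\xrightarrow{\phi_1}V_2(u)\xrightarrow{\phi_2}V_3(v)\xrightarrow{\phi_3}\cdots$$ consists of the intertwiners $\phi_{2k}(Y_u)=(\mathcal I(Y))_v$ and $\phi_{2k+1}(Z_v)=(\mathcal I(Z)\circ U)_u$, where the target of $\phi_n$ is restricted to $\mathrm{TL}_n$ along $\mathcal I_n$. Let $\widehat\phi_n$ be the intertwiner of $\mathrm{TL}_{n+1}$-modules from $\mathrm{Ind}^{\mathcal I_n}$ of the source of $\phi_n$ to its target, $\widehat\phi_n(Y\otimes w)=Y\phi_n(w)$. Finally let $$\pi_{2k}\colon \mathrm{Ind}^{\mathcal I_{2k}}(V_{2k}(u))\to V_{2k}(u)\mathbin{\widehat\times_f}V_1(v),\qquad \pi_{2k+1}\colon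 \mathrm{Ind}^{\mathcal I_{2k+1}}(V_{2k+1}(v))\to V_{2k+1}(v)\mathbin{\widehat\times_f}V_1(v^{-1})$$ be the intertwiners $\pi_{2k}(Y\otimes w)=Y\otimes(w\otimes 1_v)$ and $\pi_{2k+1}(Z\otimes w)=Z\otimes(w\otimes 1_{v^{-1}})$ of $\mathrm{TL}_{2k+1}$- and $\mathrm{TL}_{2k+2}$-modules, respectively. **Proposition.** For every $k\ge 0$ the intertwiners $\pi_{2k}$ and $\pi_{2k+1}$ are surjective, and $\widehat\phi_{2k}$ and $\widehat\phi_{2k+1}$ factor uniquely through them: there are a unique intertwiner of $\mathrm{TL}_{2k+1}$-modules $$\psi_{2k}\colon V_{2k}(u)\mathbin{\widehat\times_f}V_1(v)\to V_{2k+1}(v)\quad\text{with}\quad \psi_{2k}\circ\pi_{2k}=\widehat\phi_{2k}$$ and a unique intertwiner of $\mathrm{TL}_{2k+2}$-modules $$\psi_{2k+1}\colon V_{2k+1}(v)\mathbin{\widehat\times_f}V_1(v^{-1})\to V_{2k+2}(u)\quad\text{with}\quad \psi_{2k+1}\circ\pi_{2k+1}=\widehat\phi_{2k+1}.$$ -/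

import Mathlib

open CategoryTheory
open scoped TensorProduct Polynomial LaurentPolynomial

namespace AnnularSkein

/-- The elementary pieces of a tangle diagram in a thin round slice of the annulus. Diagrams run
from the inner to the outer boundary circle. A `cup` joins two neighbouring points of the outer
circle of the slice, a `cap` two neighbouring points of its inner circle. In a crossing the inner
points `i, i + 1` are joined to the outer points `i + 1, i`. At `crossOver` the strand from the inner
point `i` to the outer point `i + 1` passes over the other strand; at `crossUnder` it passes
under. -/
inductive Piece : Type
  | cup | cap | crossOver | crossUnder

/-- The number of points of a piece on the inner circle. -/
def Piece.inn : Piece → ℕ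
  | .cup => 0 | .cap => 2 | .crossOver => 2 | .crossUnder => 2

/-- The number of points of a piece on the outer circle. -/
def Piece.out : Piece → ℕ
  | .cup => 2 | .cap => 0 | .crossOver => 2 | .crossUnder => 2

/-- A slice with `m` points on its inner and `n` points on its outer circle. The points of every
circle are numbered `0, 1, …` counterclockwise, starting at a fixed ray. Besides its elementary
piece, at the points `i, i + 1`, a slice has only radial strands. In `rot` all strands are radial
except the last one, which runs counterclockwise through the ray, so that the inner point `j` is
joined to the outer point `j + 1` and the inner point `m - 1` to the outer point `0`; `rotInv` is the
mirror image. -/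
inductive Slice : ℕ → ℕ → Type
  | piece {m n : ℕ} (e : Piece) (i : ℕ) (hi : i + e.inn ≤ m) (hn : n + e.inn = m + e.out) :
      Slice m n
  | rot {m : ℕ} (hm : 0 < m) : Slice m m
  | rotInv {m : ℕ} (hm : 0 < m) : Slice m m

/-- A circle with `pts` marked points. -/
structure Circle : Type where
  pts : ℕ

instance : Quiver Circle := ⟨fun a b => Slice a.pts b.pts⟩

/-- Tangle diagrams in the annulus in general position with respect to the radius: words in
slices, composed from the inside to the outside. -/
abbrev Diagram : Type := Paths Circle

namespace Diagram

/-- The object `n`. -/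
abbrev pt (n : ℕ) : Diagram := (Circle.mk n : Circle)

/-- A slice as a diagram. -/
def ofSlice {m n : ℕ} (s : Slice m n) : pt m ⟶ pt n :=
  (Paths.of Circle).map (X := ⟨m⟩) (Y := ⟨n⟩) s

/-- The slice with the piece `e` at position `i`. -/
def piece {m n : ℕ} (e : Piece) (i : ℕ) (hi : i + e.inn ≤ m) (hn : n + e.inn = m + e.out) :
    pt m ⟶ pt n := ofSlice (.piece e i hi hn)

/-- A cup whose end points are the outer points `i, i + 1`. -/
def cup {m n : ℕ} (i : ℕ) (hi : i ≤ m) (hn : n = m + 2) : pt m ⟶ pt n := piece .cup i hi hn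

/-- A cap whose end points are the inner points `i, i + 1`. -/
def cap {m n : ℕ} (i : ℕ) (hi : i + 2 ≤ m) (hn : n + 2 = m) : pt m ⟶ pt n := piece .cap i hi hn

/-- A crossing at `i, i + 1`, the strand from the inner point `i` on top. -/
def crossOver {m : ℕ} (i : ℕ) (hi : i + 2 ≤ m) : pt m ⟶ pt m := piece .crossOver i hi rfl

/-- A crossing at `i, i + 1`, the strand from the inner point `i` below. -/
def crossUnder {m : ℕ} (i : ℕ) (hi : i + 2 ≤ m) : pt m ⟶ pt m := piece .crossUnder i hi rfl

/-- All points move one step counterclockwise. For `m = 1` this is the Dehn twist of a radial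
strand. -/
def rot {m : ℕ} (hm : 0 < m) : pt m ⟶ pt m := ofSlice (.rot hm)

/-- All points move one step clockwise. -/
def rotInv {m : ℕ} (hm : 0 < m) : pt m ⟶ pt m := ofSlice (.rotInv hm)

end Diagram

section Relations

open Diagram

/-- The elementary planar isotopies (fixing the boundary of the annulus) between diagrams in general
position: two pieces at a distance change their radial order (`far`), a maximum and a minimum along
a strand cancel (`zigzag_left`, `zigzag_right`), a crossing is turned past an extremum (`over_cap`,
`under_cap`, `cup_over`, `cup_under`), points move forth and back through the ray (`rot_rotInv`,
`rotInv_rot`), the radial order of a piece and of a strand running through the ray changes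
(`piece_rot`), and a piece moves through the ray (`cup_rot_rot`, `rot_rot_cap`, `over_rot_rot`,
`under_rot_rot`). There are no Reidemeister moves. -/
inductive PlanarIsotopy : HomRel Diagram
  | far (e f : Piece) {i j j' m n n' k : ℕ} (hij : i + e.inn ≤ j) (hj : j' + e.inn = j + e.out)
      (h1 : i + e.inn ≤ m) (h2 : n + e.inn = m + e.out)
      (h3 : j' + f.inn ≤ n) (h4 : k + f.inn = n + f.out)
      (h5 : j + f.inn ≤ m) (h6 : n' + f.inn = m + f.out)
      (h7 : i + e.inn ≤ n') (h8 : k + e.inn = n' + e.out) :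
      PlanarIsotopy (piece e i h1 h2 ≫ piece f j' h3 h4) (piece f j h5 h6 ≫ piece e i h7 h8)
  | zigzag_left {i m n : ℕ} (hi : i + 1 ≤ m) (hn : n = m + 2) :
      PlanarIsotopy (cup i (by omega) hn ≫ cap (i + 1) (by omega) hn.symm) (𝟙 (pt m))
  | zigzag_right {i m n : ℕ} (hi : i + 1 ≤ m) (hn : n = m + 2) :
      PlanarIsotopy (cup (i + 1) hi hn ≫ cap i (by omega) hn.symm) (𝟙 (pt m))
  | over_cap {i m n : ℕ} (hi : i + 3 ≤ m) (hn : n + 2 = m) :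
      PlanarIsotopy (crossOver (i + 1) hi ≫ cap i (by omega) hn) (crossUnder i (by omega) ≫ cap (i + 1) hi hn)
  | under_cap {i m n : ℕ} (hi : i + 3 ≤ m) (hn : n + 2 = m) :
      PlanarIsotopy (crossUnder (i + 1) hi ≫ cap i (by omega) hn) (crossOver i (by omega) ≫ cap (i + 1) hi hn)
  | cup_over {i m n : ℕ} (hi : i + 1 ≤ m) (hn : n = m + 2) :
      PlanarIsotopy (cup i (by omega) hn ≫ crossOver (i + 1) (by omega))
        (cup (i + 1) hi hn ≫ crossUnder i (by omega))
  | cup_under {i m n : ℕ} (hi : i + 1 ≤ m) (hn : n = m + 2) :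
      PlanarIsotopy (cup i (by omega) hn ≫ crossUnder (i + 1) (by omega))
        (cup (i + 1) hi hn ≫ crossOver i (by omega))
  | rot_rotInv {m : ℕ} (hm : 0 < m) : PlanarIsotopy (rot hm ≫ rotInv hm) (𝟙 (pt m))
  | rotInv_rot {m : ℕ} (hm : 0 < m) : PlanarIsotopy (rotInv hm ≫ rot hm) (𝟙 (pt m))
  | piece_rot (e : Piece) {i m n : ℕ} (hi : i + 1 + e.inn ≤ m) (hn : n + e.inn = m + e.out)
      (hm' : 0 < m) (hn' : 0 < n) :
      PlanarIsotopy (piece e i (by omega) hn ≫ rot hn') (rot hm' ≫ piece e (i + 1) hi hn)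
  | cup_rot_rot {m n : ℕ} (hn : n = m + 2) :
      PlanarIsotopy (cup m le_rfl hn ≫ rot (by omega) ≫ rot (by omega)) (cup 0 (by omega) hn)
  | rot_rot_cap {m n : ℕ} (hn : n + 2 = m) :
      PlanarIsotopy (rot (by omega) ≫ rot (by omega) ≫ cap 0 (by omega) hn) (cap n hn.le hn)
  | over_rot_rot {i m : ℕ} (hm : i + 2 = m) :
      PlanarIsotopy (crossOver i hm.le ≫ rot (by omega) ≫ rot (by omega))
        (rot (by omega) ≫ rot (by omega) ≫ crossOver 0 (by omega))
  | under_rot_rot {i m : ℕ} (hm : i + 2 = m) :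
      PlanarIsotopy (crossUnder i hm.le ≫ rot (by omega) ≫ rot (by omega))
        (rot (by omega) ≫ rot (by omega) ≫ crossUnder 0 (by omega))

/-- The category of tangle diagrams in the annulus up to planar isotopy: the quotient by the
congruence that `PlanarIsotopy` generates. -/
abbrev Tangle : Type := CategoryTheory.Quotient PlanarIsotopy

/-- Formal complex linear combinations of tangle diagrams up to planar isotopy. -/
abbrev LinTangle : Type := Free ℂ Tangle

/-- A diagram as an element of the linearised category. -/
noncomputable def toLin : Diagram ⥤ LinTangle :=
  CategoryTheory.Quotient.functor PlanarIsotopy ⋙ Free.embedding ℂ Tangle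

/-- The linear congruence generated by the Kauffman skein relation, with parameter `q`, which
replaces a crossing by `q` times one smoothing plus `q⁻¹` times the other, and by the removal of a
contractible loop at the price of the factor `-(q² + q⁻²)`. -/
inductive SkeinRel (q : ℂˣ) : HomRel LinTangle
  | crossOver {i m n : ℕ} (hi : i + 2 ≤ m) (hn : n + 2 = m) :
      SkeinRel q (toLin.map (crossOver i hi))
        ((q : ℂ) • toLin.map (𝟙 (pt m)) +
          ((q⁻¹ : ℂˣ) : ℂ) • toLin.map (cap i hi hn ≫ cup i (by omega) hn.symm))
  | crossUnder {i m n : ℕ} (hi : i + 2 ≤ m) (hn : n + 2 = m) :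
      SkeinRel q (toLin.map (crossUnder i hi))
        ((q : ℂ) • toLin.map (cap i hi hn ≫ cup i (by omega) hn.symm) +
          ((q⁻¹ : ℂˣ) : ℂ) • toLin.map (𝟙 (pt m)))
  | loop {i m n : ℕ} (hi : i ≤ m) (hn : n = m + 2) :
      SkeinRel q (toLin.map (cup i hi hn ≫ cap i (by omega) hn.symm))
        ((-((q : ℂ) ^ 2 + ((q⁻¹ : ℂˣ) : ℂ) ^ 2)) • toLin.map (𝟙 (pt m)))
  | refl {X Y : LinTangle} (f : X ⟶ Y) : SkeinRel q f f
  | symm {X Y : LinTangle} {f g : X ⟶ Y} : SkeinRel q f g → SkeinRel q g f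
  | trans {X Y : LinTangle} {f g h : X ⟶ Y} :
      SkeinRel q f g → SkeinRel q g h → SkeinRel q f h
  | add {X Y : LinTangle} {f g f' g' : X ⟶ Y} :
      SkeinRel q f g → SkeinRel q f' g' → SkeinRel q (f + f') (g + g')
  | smul {X Y : LinTangle} (c : ℂ) {f g : X ⟶ Y} : SkeinRel q f g → SkeinRel q (c • f) (c • g)
  | comp {X Y Z : LinTangle} {f f' : X ⟶ Y} {g g' : Y ⟶ Z} :
      SkeinRel q f f' → SkeinRel q g g' → SkeinRel q (f ≫ g) (f' ≫ g')

end Relations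

instance (q : ℂˣ) : Congruence (SkeinRel q) where
  comp_left f _ _ h := .comp (.refl f) h
  comp_right g h := .comp h (.refl g)
  equivalence := ⟨.refl, .symm, .trans⟩

/-- The skein category of the annulus. -/
abbrev Skein (q : ℂˣ) : Type := CategoryTheory.Quotient (SkeinRel q)

noncomputable instance (q : ℂˣ) : Preadditive (Skein q) :=
  CategoryTheory.Quotient.preadditive _ (fun _ _ _ _ _ _ h h' => .add h h')

instance (q : ℂˣ) : (CategoryTheory.Quotient.functor (SkeinRel q)).Additive :=
  CategoryTheory.Quotient.functor_additive _ (fun _ _ _ _ _ _ h h' => .add h h')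

noncomputable instance (q : ℂˣ) : Linear ℂ (Skein q) :=
  CategoryTheory.Quotient.linear ℂ _ (fun c _ _ _ _ h => .smul c h)

instance (q : ℂˣ) : (CategoryTheory.Quotient.functor (SkeinRel q)).Linear ℂ :=
  CategoryTheory.Quotient.linear_functor ℂ _ (fun c _ _ _ _ h => .smul c h)

/-- The class of a diagram in the skein category. -/
noncomputable def toSkein (q : ℂˣ) : Diagram ⥤ Skein q :=
  toLin ⋙ CategoryTheory.Quotient.functor (SkeinRel q)

namespace Skein

variable {q : ℂˣ}

/-- The object `n` of the skein category. -/
noncomputable abbrev pt (q : ℂˣ) (n : ℕ) : Skein q := (toSkein q).obj (Diagram.pt n)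

/-- The class of an elementary piece. -/
noncomputable def el {m n : ℕ} (e : Piece) (i : ℕ) (hi : i + e.inn ≤ m)
    (hn : n + e.inn = m + e.out) : pt q m ⟶ pt q n :=
  (toSkein q).map (Diagram.piece e i hi hn)

/-- The class of the rotation by one step; for `m = 1`, of the Dehn twist. -/
noncomputable def rot {m : ℕ} (hm : 0 < m) : pt q m ⟶ pt q m := (toSkein q).map (Diagram.rot hm)

/-- The class of the inverse rotation. -/
noncomputable def rotInv {m : ℕ} (hm : 0 < m) : pt q m ⟶ pt q m :=
  (toSkein q).map (Diagram.rotInv hm)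

theorem toSkein_eq {X Y : Diagram} {D D' : X ⟶ Y} (h : PlanarIsotopy D D') :
    (toSkein q).map D = (toSkein q).map D' := by
  have : toLin.map D = toLin.map D' := by
    simp only [toLin, Functor.comp_map]
    rw [CategoryTheory.Quotient.sound _ h]
  simp only [toSkein, Functor.comp_map, this]

theorem skein_eq {X Y : LinTangle} {f g : X ⟶ Y} (h : SkeinRel q f g) :
    (CategoryTheory.Quotient.functor (SkeinRel q)).map f =
      (CategoryTheory.Quotient.functor (SkeinRel q)).map g :=
  CategoryTheory.Quotient.sound _ h

theorem far {e f : Piece} {i j j' m n n' k : ℕ} (hij : i + e.inn ≤ j)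
    (hj : j' + e.inn = j + e.out)
    {h1 : i + e.inn ≤ m} {h2 : n + e.inn = m + e.out}
    {h3 : j' + f.inn ≤ n} {h4 : k + f.inn = n + f.out}
    {h6 : n' + f.inn = m + f.out} :
    (el e i h1 h2 : pt q m ⟶ pt q n) ≫ (el f j' h3 h4 : pt q n ⟶ pt q k) =
      (el f j (by omega) h6 : pt q m ⟶ pt q n') ≫ el e i (by omega) (by omega) := by
  have := toSkein_eq (q := q) (PlanarIsotopy.far e f hij hj h1 h2 h3 h4
    (by omega) h6 (by omega) (by omega))
  simpa only [Functor.map_comp] using! this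

theorem zigzag_left {i j m n : ℕ} (hj : j = i + 1) {h1 : i + Piece.cup.inn ≤ m}
    {h2 : n + Piece.cup.inn = m + Piece.cup.out}
    {h3 : j + Piece.cap.inn ≤ n} {h4 : m + Piece.cap.inn = n + Piece.cap.out} :
    (el .cup i h1 h2 : pt q m ⟶ pt q n) ≫ (el .cap j h3 h4 : pt q n ⟶ pt q m) = 𝟙 _ := by
  subst hj
  simp only [Piece.inn, Piece.out] at h1 h2 h3 h4
  have := toSkein_eq (q := q) (PlanarIsotopy.zigzag_left (i := i) (m := m) (n := n)
    (by omega) (by omega))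
  simpa only [Functor.map_comp, Functor.map_id] using! this

theorem zigzag_right {i j m n : ℕ} (hj : j = i + 1) {h1 : j + Piece.cup.inn ≤ m}
    {h2 : n + Piece.cup.inn = m + Piece.cup.out}
    {h3 : i + Piece.cap.inn ≤ n} {h4 : m + Piece.cap.inn = n + Piece.cap.out} :
    (el .cup j h1 h2 : pt q m ⟶ pt q n) ≫ (el .cap i h3 h4 : pt q n ⟶ pt q m) = 𝟙 _ := by
  subst hj
  simp only [Piece.inn, Piece.out] at h1 h2 h3 h4
  have := toSkein_eq (q := q) (PlanarIsotopy.zigzag_right (i := i) (m := m) (n := n)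
    (by omega) (by omega))
  simpa only [Functor.map_comp, Functor.map_id] using! this

@[simp] theorem rot_rotInv {m : ℕ} (hm : 0 < m) : (rot hm : pt q m ⟶ _) ≫ rotInv hm = 𝟙 _ := by
  simpa only [Functor.map_comp, Functor.map_id] using!
    toSkein_eq (q := q) (PlanarIsotopy.rot_rotInv hm)

@[simp] theorem rotInv_rot {m : ℕ} (hm : 0 < m) : (rotInv hm : pt q m ⟶ _) ≫ rot hm = 𝟙 _ := by
  simpa only [Functor.map_comp, Functor.map_id] using!
    toSkein_eq (q := q) (PlanarIsotopy.rotInv_rot hm)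

theorem el_rot {e : Piece} {i j m n : ℕ} (hj : j = i + 1) (hm' : 0 < m)
    {h1 : i + e.inn ≤ m} {hn : n + e.inn = m + e.out} {hn' : 0 < n} (hi : j + e.inn ≤ m) :
    (el e i h1 hn : pt q m ⟶ pt q n) ≫ rot hn' = rot hm' ≫ el e j hi hn := by
  subst hj
  simpa only [Functor.map_comp, Functor.map_id] using!
    toSkein_eq (q := q) (PlanarIsotopy.piece_rot e hi hn hm' hn')

theorem cup_rot_rot {m n : ℕ} {h1 : m + Piece.cup.inn ≤ m}
    {h2 : n + Piece.cup.inn = m + Piece.cup.out} {hn' : 0 < n} :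
    (el .cup m h1 h2 : pt q m ⟶ pt q n) ≫ rot hn' ≫ rot hn' =
      el .cup 0 (by simp [Piece.inn]) h2 := by
  simpa only [Functor.map_comp, Functor.map_id] using!
    toSkein_eq (q := q) (PlanarIsotopy.cup_rot_rot (m := m) (n := n) h2)

theorem rot_rot_cap {m n : ℕ} {h1 : 0 + Piece.cap.inn ≤ m}
    {h2 : n + Piece.cap.inn = m + Piece.cap.out} {hm' : 0 < m} :
    rot hm' ≫ rot hm' ≫ (el .cap 0 h1 h2 : pt q m ⟶ pt q n) =
      el .cap n h2.le h2 := by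
  simpa only [Functor.map_comp, Functor.map_id] using!
    toSkein_eq (q := q) (PlanarIsotopy.rot_rot_cap (m := m) (n := n) h2)

theorem cup_over_under {s s' : Piece} (hs : s = .crossOver ∧ s' = .crossUnder ∨ s = .crossUnder ∧ s' = .crossOver)
    {i j m n : ℕ} (hj : j = i + 1) {h1 : i + Piece.cup.inn ≤ m}
    {h2 : n + Piece.cup.inn = m + Piece.cup.out}
    {h3 : j + s.inn ≤ n} {h4 : n + s.inn = n + s.out} (h5 : j + Piece.cup.inn ≤ m)
    (h6 : i + s'.inn ≤ n) (h7 : n + s'.inn = n + s'.out) :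
    (el .cup i h1 h2 : pt q m ⟶ pt q n) ≫ (el s j h3 h4 : pt q n ⟶ pt q n) =
      el .cup j h5 h2 ≫ el s' i h6 h7 := by
  subst hj
  rcases hs with ⟨rfl, rfl⟩ | ⟨rfl, rfl⟩
  · simpa only [Functor.map_comp] using!
      toSkein_eq (q := q) (PlanarIsotopy.cup_over (i := i) (m := m) (n := n) h5 h2)
  · simpa only [Functor.map_comp] using!
      toSkein_eq (q := q) (PlanarIsotopy.cup_under (i := i) (m := m) (n := n) h5 h2)

theorem over_under_cap {s s' : Piece} (hs : s = .crossOver ∧ s' = .crossUnder ∨ s = .crossUnder ∧ s' = .crossOver)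
    {i j m n : ℕ} (hj : j = i + 1) {h1 : i + Piece.cap.inn ≤ m}
    {h2 : n + Piece.cap.inn = m + Piece.cap.out}
    {h3 : j + s.inn ≤ m} {h4 : m + s.inn = m + s.out} (h5 : j + Piece.cap.inn ≤ m)
    (h6 : i + s'.inn ≤ m) (h7 : m + s'.inn = m + s'.out) :
    (el s j h3 h4 : pt q m ⟶ pt q m) ≫ (el .cap i h1 h2 : pt q m ⟶ pt q n) =
      el s' i h6 h7 ≫ el .cap j h5 h2 := by
  subst hj
  rcases hs with ⟨rfl, rfl⟩ | ⟨rfl, rfl⟩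
  · simpa only [Functor.map_comp] using!
      toSkein_eq (q := q) (PlanarIsotopy.over_cap (i := i) (m := m) (n := n) h5 h2)
  · simpa only [Functor.map_comp] using!
      toSkein_eq (q := q) (PlanarIsotopy.under_cap (i := i) (m := m) (n := n) h5 h2)

theorem cross_rot_rot {s : Piece} (hs : s = .crossOver ∨ s = .crossUnder) {i m : ℕ} (hm : i + 2 = m)
    {h1 : i + s.inn ≤ m} {h2 : m + s.inn = m + s.out} {hm' : 0 < m} (h3 : 0 + s.inn ≤ m) :
    (el s i h1 h2 : pt q m ⟶ pt q m) ≫ rot hm' ≫ rot hm' =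
      rot hm' ≫ rot hm' ≫ el s 0 h3 h2 := by
  rcases hs with rfl | rfl
  · simpa only [Functor.map_comp] using!
      toSkein_eq (q := q) (PlanarIsotopy.over_rot_rot hm)
  · simpa only [Functor.map_comp] using!
      toSkein_eq (q := q) (PlanarIsotopy.under_rot_rot hm)

theorem over_eq {i m n : ℕ} {h1 : i + Piece.crossOver.inn ≤ m}
    {h2 : m + Piece.crossOver.inn = m + Piece.crossOver.out} (hn : n + 2 = m) :
    (el .crossOver i h1 h2 : pt q m ⟶ pt q m) = (q : ℂ) • 𝟙 _ + ((q⁻¹ : ℂˣ) : ℂ) •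
      ((el .cap i h1 hn : pt q m ⟶ pt q n) ≫ el .cup i (by simp only [Piece.inn] at *; omega)
        hn.symm) := by
  have := skein_eq (SkeinRel.crossOver (q := q) (i := i) h1 hn)
  rw [Functor.map_add, Functor.map_smul, Functor.map_smul] at this
  change (toSkein q).map _ = _ • (toSkein q).map _ + _ • (toSkein q).map _ at this
  simpa only [Functor.map_comp, Functor.map_id] using! this

theorem under_eq {i m n : ℕ} {h1 : i + Piece.crossUnder.inn ≤ m}
    {h2 : m + Piece.crossUnder.inn = m + Piece.crossUnder.out} (hn : n + 2 = m) :
    (el .crossUnder i h1 h2 : pt q m ⟶ pt q m) = (q : ℂ) •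
      ((el .cap i h1 hn : pt q m ⟶ pt q n) ≫ el .cup i (by simp only [Piece.inn] at *; omega)
        hn.symm) + ((q⁻¹ : ℂˣ) : ℂ) • 𝟙 _ := by
  have := skein_eq (SkeinRel.crossUnder (q := q) (i := i) h1 hn)
  rw [Functor.map_add, Functor.map_smul, Functor.map_smul] at this
  change (toSkein q).map _ = _ • (toSkein q).map _ + _ • (toSkein q).map _ at this
  simpa only [Functor.map_comp, Functor.map_id] using! this

theorem loop_eq {i m n : ℕ} {h1 : i + Piece.cup.inn ≤ m}
    {h2 : n + Piece.cup.inn = m + Piece.cup.out}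
    {h3 : i + Piece.cap.inn ≤ n} {h4 : m + Piece.cap.inn = n + Piece.cap.out} :
    (el .cup i h1 h2 : pt q m ⟶ pt q n) ≫ (el .cap i h3 h4 : pt q n ⟶ pt q m) =
      (-((q : ℂ) ^ 2 + ((q⁻¹ : ℂˣ) : ℂ) ^ 2)) • 𝟙 _ := by
  have := skein_eq (SkeinRel.loop (q := q) (i := i) (m := m) (n := n) h1 h2)
  rw [Functor.map_smul] at this
  change (toSkein q).map _ = _ • (toSkein q).map _ at this
  simpa only [Functor.map_comp, Functor.map_id] using! this

/-- The linear extension of a functor on diagrams that respects planar isotopy. -/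
noncomputable def liftLin (F : Diagram ⥤ Skein q)
    (hF : ∀ ⦃X Y : Diagram⦄ (D D' : X ⟶ Y), PlanarIsotopy D D' → F.map D = F.map D') :
    LinTangle ⥤ Skein q :=
  Free.lift ℂ (CategoryTheory.Quotient.lift PlanarIsotopy F hF)

instance liftLin_additive (F : Diagram ⥤ Skein q)
    (hF : ∀ ⦃X Y : Diagram⦄ (D D' : X ⟶ Y), PlanarIsotopy D D' → F.map D = F.map D') :
    (liftLin F hF).Additive := by unfold liftLin; infer_instance

instance liftLin_linear (F : Diagram ⥤ Skein q)
    (hF : ∀ ⦃X Y : Diagram⦄ (D D' : X ⟶ Y), PlanarIsotopy D D' → F.map D = F.map D') :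
    (liftLin F hF).Linear ℂ := by unfold liftLin; infer_instance

theorem liftLin_map (F : Diagram ⥤ Skein q)
    (hF : ∀ ⦃X Y : Diagram⦄ (D D' : X ⟶ Y), PlanarIsotopy D D' → F.map D = F.map D')
    {X Y : Diagram} (D : X ⟶ Y) : (liftLin F hF).map (toLin.map D) = F.map D := by
  refine (Free.lift_map_single ℂ _ _ _).trans ?_
  rw [one_smul]; rfl

/-- A functor on diagrams respects planar isotopy and the skein relations. -/
structure Respects (F : Diagram ⥤ Skein q) : Prop where
  iso : ∀ ⦃X Y : Diagram⦄ (D D' : X ⟶ Y), PlanarIsotopy D D' → F.map D = F.map D'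
  crossOver : ∀ {i m n : ℕ} (hi : i + 2 ≤ m) (hn : n + 2 = m), F.map (Diagram.crossOver i hi) =
    (q : ℂ) • 𝟙 _ + ((q⁻¹ : ℂˣ) : ℂ) •
      (F.map (Diagram.cap i hi hn) ≫ F.map (Diagram.cup i (by omega) hn.symm))
  crossUnder : ∀ {i m n : ℕ} (hi : i + 2 ≤ m) (hn : n + 2 = m), F.map (Diagram.crossUnder i hi) =
    (q : ℂ) • (F.map (Diagram.cap i hi hn) ≫ F.map (Diagram.cup i (by omega) hn.symm)) +
      ((q⁻¹ : ℂˣ) : ℂ) • 𝟙 _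
  loop : ∀ {i m n : ℕ} (hi : i ≤ m) (hn : n = m + 2),
    F.map (Diagram.cup i hi hn) ≫ F.map (Diagram.cap i (by omega) hn.symm) =
      (-((q : ℂ) ^ 2 + ((q⁻¹ : ℂˣ) : ℂ) ^ 2)) • 𝟙 _

theorem Respects.skein {F : Diagram ⥤ Skein q} (hF : Respects F) (X Y : LinTangle) (f g : X ⟶ Y)
    (h : SkeinRel q f g) : (liftLin F hF.iso).map f = (liftLin F hF.iso).map g := by
  induction h with
  | crossOver hi hn => simpa [Functor.map_smul, liftLin_map] using! hF.crossOver hi hn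
  | crossUnder hi hn => simpa [Functor.map_smul, liftLin_map] using! hF.crossUnder hi hn
  | loop hi hn => simpa [Functor.map_smul, liftLin_map] using! hF.loop hi hn
  | refl f => rfl
  | symm _ ih => exact ih.symm
  | trans _ _ ih ih2 => exact ih.trans ih2
  | add _ _ ih ih2 => rw [Functor.map_add, Functor.map_add, ih, ih2]
  | smul c _ ih => rw [Functor.map_smul, Functor.map_smul, ih]
  | comp _ _ ih ih2 => rw [Functor.map_comp, Functor.map_comp, ih, ih2]

/-- The functor that such a functor induces on the skein category. -/
noncomputable def lift (F : Diagram ⥤ Skein q) (hF : Respects F) : Skein q ⥤ Skein q :=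
  CategoryTheory.Quotient.lift (SkeinRel q) (liftLin F hF.iso) hF.skein

theorem lift_map (F : Diagram ⥤ Skein q) (hF : Respects F) {X Y : Diagram} (D : X ⟶ Y) :
    (lift F hF).map ((toSkein q).map D) = F.map D := liftLin_map F hF.iso D

instance (F : Diagram ⥤ Skein q) (hF : Respects F) : (lift F hF).Additive where
  map_add {X Y f g} := by
    obtain ⟨f, rfl⟩ := (CategoryTheory.Quotient.functor (SkeinRel q)).map_surjective f
    obtain ⟨g, rfl⟩ := (CategoryTheory.Quotient.functor (SkeinRel q)).map_surjective g
    exact (liftLin F hF.iso).map_add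

instance (F : Diagram ⥤ Skein q) (hF : Respects F) : (lift F hF).Linear ℂ where
  map_smul {X Y} f c := by
    obtain ⟨f, rfl⟩ := (CategoryTheory.Quotient.functor (SkeinRel q)).map_surjective f
    exact (liftLin F hF.iso).map_smul c f

theorem ind {X Y : Skein q} (P : (X ⟶ Y) → Prop)
    (hD : ∀ D : X.as.as ⟶ Y.as.as, P ((toSkein q).map D))
    (hzero : P 0) (hadd : ∀ f g, P f → P g → P (f + g)) (hsmul : ∀ (c : ℂ) f, P f → P (c • f)) (f : X ⟶ Y) :
    P f := by
  obtain ⟨f, rfl⟩ := (CategoryTheory.Quotient.functor (SkeinRel q)).map_surjective f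
  have key : ∀ g : ((show Tangle from X.as) ⟶ (show Tangle from Y.as)) →₀ ℂ,
      P ((CategoryTheory.Quotient.functor (SkeinRel q)).map (X := X.as) (Y := Y.as) g) := by
    have h1 : ∀ g : (show Tangle from X.as) ⟶ (show Tangle from Y.as),
        P ((CategoryTheory.Quotient.functor (SkeinRel q)).map (X := X.as) (Y := Y.as)
          ((Free.embedding ℂ Tangle).map g)) := by
      intro g
      obtain ⟨D, rfl⟩ := (CategoryTheory.Quotient.functor PlanarIsotopy).map_surjective g
      exact hD D
    intro g
    induction g using Finsupp.induction_linear with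
    | zero => exact hzero
    | add f g hf hg => exact hadd _ _ hf hg
    | single g c =>
      have h2 := CategoryTheory.Functor.map_smul (R := ℂ)
        (CategoryTheory.Quotient.functor (SkeinRel q)) c ((Free.embedding ℂ Tangle).map g)
      have h3 : (c • (Free.embedding ℂ Tangle).map g :) = Finsupp.single g c :=
        Finsupp.smul_single_one g c
      rw [← h3]
      exact Eq.mpr (congrArg P h2) (hsmul c _ (h1 g))
  exact key f

theorem word_ind (P : ∀ {m n : ℕ}, (pt q m ⟶ pt q n) → Prop)
    (hid : ∀ m, P (𝟙 (pt q m)))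
    (hcomp : ∀ {m n k : ℕ} (f : pt q m ⟶ pt q n) (g : pt q n ⟶ pt q k), P f → P g → P (f ≫ g))
    (hel : ∀ {m n : ℕ} (e : Piece) (i : ℕ) (hi : i + e.inn ≤ m) (hn : n + e.inn = m + e.out),
      P (el e i hi hn : pt q m ⟶ pt q n))
    (hrot : ∀ {m : ℕ} (hm : 0 < m), P (rot hm : pt q m ⟶ pt q m))
    (hrotInv : ∀ {m : ℕ} (hm : 0 < m), P (rotInv hm : pt q m ⟶ pt q m))
    {m n : ℕ} (D : Diagram.pt m ⟶ Diagram.pt n) : P ((toSkein q).map D) := by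
  refine Paths.induction (V := Circle)
    (P := fun {a b} D => P (m := a.pts) (n := b.pts) ((toSkein q).map D)) ?_ ?_ D
  · intro v; exact hid _
  · intro u v w p s hp
    refine Eq.mpr (congrArg (fun f => P (m := u.pts) (n := w.pts) f) ((toSkein q).map_comp _ _))
      (hcomp (m := u.pts) (n := v.pts) (k := w.pts) _ _ hp ?_)
    obtain ⟨v⟩ := v
    obtain ⟨w⟩ := w
    change Slice v w at s
    clear hp p
    cases s with
    | piece e i hi hn => exact hel e i hi hn
    | rot hm => exact hrot hm
    | rotInv hm => exact hrotInv hm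

end Skein

/-- The composite `σ_a, σ_{a+1}, …, σ_{a+k-1}`, in this order. -/
def climb {C : Type*} [Category C] {X : C} {N : ℕ} (σ : ∀ i : ℕ, i + 2 ≤ N → (X ⟶ X)) (a : ℕ) :
    (k : ℕ) → a + k + 1 ≤ N → (X ⟶ X)
  | 0, _ => 𝟙 X
  | k + 1, h => climb σ a k (by omega) ≫ σ (a + k) (by omega)

/-- The composite `σ_{a+k-1}, …, σ_{a+1}, σ_a`, in this order. -/
def descend {C : Type*} [Category C] {X : C} {N : ℕ} (σ : ∀ i : ℕ, i + 2 ≤ N → (X ⟶ X)) (a : ℕ) :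
    (k : ℕ) → a + k + 1 ≤ N → (X ⟶ X)
  | 0, _ => 𝟙 X
  | k + 1, h => σ (a + k) (by omega) ≫ descend σ a k (by omega)

section Climb

variable {C : Type*} [Category C]

theorem climb_add {X : C} {N : ℕ} (σ : ∀ i : ℕ, i + 2 ≤ N → (X ⟶ X)) (a k l : ℕ)
    (h : a + (k + l) + 1 ≤ N) :
    climb σ a (k + l) h = climb σ a k (by omega) ≫ climb σ (a + k) l (by omega) := by
  induction l with
  | zero => simp [climb]
  | succ l ih =>
    change climb σ a (k + l) _ ≫ σ (a + (k + l)) _ = _ ≫ climb σ (a + k) l _ ≫ σ (a + k + l) _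
    rw [ih (by omega), Category.assoc]
    simp only [Nat.add_assoc]

theorem climb_comm {X Y : C} {N N' : ℕ} (σ : ∀ i : ℕ, i + 2 ≤ N → (X ⟶ X))
    (τ : ∀ i : ℕ, i + 2 ≤ N' → (Y ⟶ Y)) (f : X ⟶ Y) (a b k : ℕ)
    (h : a + k + 1 ≤ N) (h' : b + k + 1 ≤ N')
    (H : ∀ j, j < k → ∀ (g : a + j + 2 ≤ N) (g' : b + j + 2 ≤ N'),
      σ (a + j) g ≫ f = f ≫ τ (b + j) g') :
    climb σ a k h ≫ f = f ≫ climb τ b k h' := by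
  induction k with
  | zero => simp [climb]
  | succ k ih =>
    simp only [climb, Category.assoc]
    rw [H k (by omega), reassoc_of% (ih (by omega) (by omega) fun j hj => H j (by omega))]

theorem climb_descend {X : C} {N : ℕ} (σ τ : ∀ i : ℕ, i + 2 ≤ N → (X ⟶ X))
    (H : ∀ i h, σ i h ≫ τ i h = 𝟙 X) (a k : ℕ) (h : a + k + 1 ≤ N) :
    climb σ a k h ≫ descend τ a k h = 𝟙 X := by
  induction k with
  | zero => simp [climb, descend]
  | succ k ih => simp only [climb, descend, Category.assoc, reassoc_of% H, ih]

theorem descend_climb {X : C} {N : ℕ} (σ τ : ∀ i : ℕ, i + 2 ≤ N → (X ⟶ X))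
    (H : ∀ i h, σ i h ≫ τ i h = 𝟙 X) (a k : ℕ) (h : a + k + 1 ≤ N) :
    descend σ a k h ≫ climb τ a k h = 𝟙 X := by
  induction k with
  | zero => simp [climb, descend]
  | succ k ih => simp only [climb, descend, Category.assoc, reassoc_of% ih, H]

theorem map_climb {D : Type*} [Category D] (F : C ⥤ D) {X : C} {N : ℕ}
    (σ : ∀ i : ℕ, i + 2 ≤ N → (X ⟶ X)) (a k : ℕ) (h : a + k + 1 ≤ N) :
    F.map (climb σ a k h) = climb (fun i hi => F.map (σ i hi)) a k h := by
  induction k with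
  | zero => simp [climb]
  | succ k ih => simp only [climb, F.map_comp, ih]

theorem map_descend {D : Type*} [Category D] (F : C ⥤ D) {X : C} {N : ℕ}
    (σ : ∀ i : ℕ, i + 2 ≤ N → (X ⟶ X)) (a k : ℕ) (h : a + k + 1 ≤ N) :
    F.map (descend σ a k h) = descend (fun i hi => F.map (σ i hi)) a k h := by
  induction k with
  | zero => simp [descend]
  | succ k ih => simp only [descend, F.map_comp, ih]

end Climb

namespace Skein

variable {q : ℂˣ}

/-- The class of a cup. -/
noncomputable def cu {m n : ℕ} (i : ℕ) (hi : i ≤ m) (hn : n = m + 2) : pt q m ⟶ pt q n :=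
  el .cup i hi hn

/-- The class of a cap. -/
noncomputable def ca {m n : ℕ} (i : ℕ) (hi : i + 2 ≤ m) (hn : n + 2 = m) : pt q m ⟶ pt q n :=
  el .cap i hi hn

/-- The class of a crossing: of `crossOver` for `true`, of `crossUnder` for `false`. -/
noncomputable def cr {m : ℕ} : (b : Bool) → (i : ℕ) → (hi : i + 2 ≤ m) → (pt q m ⟶ pt q m)
  | true, i, hi => el .crossOver i hi rfl
  | false, i, hi => el .crossUnder i hi rfl

theorem cr_eq (b : Bool) : ∃ x y : ℂ, ∀ {i m n : ℕ} (hi : i + 2 ≤ m) (hn : n + 2 = m),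
    (cr b i hi : pt q m ⟶ pt q m) = x • 𝟙 _ + y • ((ca i hi hn : pt q m ⟶ pt q n) ≫
      cu i (by omega) hn.symm) := by
  cases b
  · exact ⟨_, _, fun {i m n} hi hn => (under_eq hn).trans (add_comm _ _)⟩
  · exact ⟨_, _, fun {i m n} hi hn => over_eq hn⟩

theorem cu_ca_left {i j m n : ℕ} (hj : j = i + 1) (h1 : i ≤ m) (h2 : n = m + 2)
    (h3 : j + 2 ≤ n) (h4 : m + 2 = n) :
    (cu i h1 h2 : pt q m ⟶ pt q n) ≫ ca j h3 h4 = 𝟙 _ := zigzag_left hj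

theorem cu_ca_right {i j m n : ℕ} (hj : j = i + 1) (h1 : j ≤ m) (h2 : n = m + 2)
    (h3 : i + 2 ≤ n) (h4 : m + 2 = n) :
    (cu j h1 h2 : pt q m ⟶ pt q n) ≫ ca i h3 h4 = 𝟙 _ := zigzag_right hj

theorem cu_ca_loop {i m n : ℕ} (h1 : i ≤ m) (h2 : n = m + 2)
    (h3 : i + 2 ≤ n) (h4 : m + 2 = n) :
    (cu i h1 h2 : pt q m ⟶ pt q n) ≫ ca i h3 h4 =
      (-((q : ℂ) ^ 2 + ((q⁻¹ : ℂˣ) : ℂ) ^ 2)) • 𝟙 _ := loop_eq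

theorem cu_cr {i j m n : ℕ} (b : Bool) (hj : j = i + 1) (h1 : i ≤ m) (h2 : n = m + 2)
    (h3 : j + 2 ≤ n) (h5 : j ≤ m) (h6 : i + 2 ≤ n) :
    (cu i h1 h2 : pt q m ⟶ pt q n) ≫ cr b j h3 = cu j h5 h2 ≫ cr (!b) i h6 := by
  cases b
  · exact cup_over_under (.inr ⟨rfl, rfl⟩) hj h5 h6 rfl
  · exact cup_over_under (.inl ⟨rfl, rfl⟩) hj h5 h6 rfl

theorem cr_ca {i j m n : ℕ} (b : Bool) (hj : j = i + 1) (h1 : i + 2 ≤ m) (h2 : n + 2 = m)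
    (h3 : j + 2 ≤ m) (h6 : i + 2 ≤ m) :
    cr b j h3 ≫ (ca i h1 h2 : pt q m ⟶ pt q n) = cr (!b) i h6 ≫ ca j h3 h2 := by
  cases b
  · exact over_under_cap (.inr ⟨rfl, rfl⟩) hj h3 h6 rfl
  · exact over_under_cap (.inl ⟨rfl, rfl⟩) hj h3 h6 rfl

theorem over_under_cancel {i m : ℕ} (h : i + 2 ≤ m) :
    (cr true i h : pt q m ⟶ pt q m) ≫ cr false i h = 𝟙 _ ∧
    (cr false i h : pt q m ⟶ pt q m) ≫ cr true i h = 𝟙 _ := by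
  obtain ⟨n, rfl⟩ : ∃ n, m = n + 2 := ⟨m - 2, by omega⟩
  have hl := cu_ca_loop (q := q) (i := i) (m := n) (n := n + 2) (by omega) rfl h rfl
  have ho : (cr true i h : pt q (n + 2) ⟶ pt q (n + 2)) = _ := over_eq rfl
  have hu : (cr false i h : pt q (n + 2) ⟶ pt q (n + 2)) = _ := under_eq rfl
  change _ = (q : ℂ) • _ + _ • ((ca i h rfl : pt q (n + 2) ⟶ pt q n) ≫ cu i (by omega) rfl) at ho
  change _ = (q : ℂ) • ((ca i h rfl : pt q (n + 2) ⟶ pt q n) ≫ cu i (by omega) rfl) + _ at hu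
  have hq : (q : ℂ) * ((q⁻¹ : ℂˣ) : ℂ) = 1 := by simp
  generalize ((q⁻¹ : ℂˣ) : ℂ) = u at *
  generalize (q : ℂ) = w at *
  generalize (cu i (by omega) rfl : pt q n ⟶ pt q (n + 2)) = U at *
  generalize (ca i h rfl : pt q (n + 2) ⟶ pt q n) = A at *
  have hl2 : A ≫ U ≫ A ≫ U = (-(w ^ 2 + u ^ 2)) • (A ≫ U) := by
    rw [reassoc_of% hl, Linear.smul_comp, Category.id_comp, Linear.comp_smul]
  rw [ho, hu]
  simp only [Preadditive.add_comp, Preadditive.comp_add, Linear.smul_comp, Linear.comp_smul,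
    Category.id_comp, Category.comp_id, Category.assoc, hl2, smul_smul]
  constructor <;> match_scalars <;>
    first
    | linear_combination hq
    | linear_combination (-w ^ 2 - u ^ 2) * hq

theorem cr_cancel {i m : ℕ} (b : Bool) (h h' : i + 2 ≤ m) :
    (cr b i h : pt q m ⟶ pt q m) ≫ cr (!b) i h' = 𝟙 _ := by
  cases b
  · exact (over_under_cancel h).2
  · exact (over_under_cancel h).1

theorem cr_cancel' {i m : ℕ} (b : Bool) (h h' : i + 2 ≤ m) :
    (cr (!b) i h : pt q m ⟶ pt q m) ≫ cr b i h' = 𝟙 _ := by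
  simpa using cr_cancel (q := q) (!b) h h'

theorem el_cr {e : Piece} {i j j' m n : ℕ} (b : Bool) (hij : i + e.inn ≤ j)
    (hj : j' + e.inn = j + e.out) (h1 : i + e.inn ≤ m) (h2 : n + e.inn = m + e.out)
    (h3 : j' + 2 ≤ n) (h4 : j + 2 ≤ m) :
    (el e i h1 h2 : pt q m ⟶ pt q n) ≫ cr b j' h3 = cr b j h4 ≫ el e i h1 h2 := by
  cases b <;> exact far hij hj

theorem cr_el {e : Piece} {i j m n : ℕ} (b : Bool) (hij : i + 2 ≤ j)
    (h1 : j + e.inn ≤ m) (h2 : n + e.inn = m + e.out)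
    (h3 : i + 2 ≤ m) (h4 : i + 2 ≤ n) :
    cr b i h3 ≫ (el e j h1 h2 : pt q m ⟶ pt q n) = el e j h1 h2 ≫ cr b i h4 := by
  cases b <;> exact far hij rfl

theorem cr_far {i j m : ℕ} (b b' : Bool) (hij : i + 2 ≤ j) (h1 : i + 2 ≤ m) (h2 : j + 2 ≤ m) :
    (cr b i h1 : pt q m ⟶ pt q m) ≫ cr b' j h2 = cr b' j h2 ≫ cr b i h1 := by
  cases b' <;> exact cr_el b hij h2 rfl _ _

theorem cr_rot {i j m : ℕ} (b : Bool) (hj : j = i + 1) (h1 : i + 2 ≤ m) (h2 : j + 2 ≤ m)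
    (hm hm' : 0 < m) :
    (cr b i h1 : pt q m ⟶ pt q m) ≫ rot hm = rot hm' ≫ cr b j h2 := by
  cases b
  · exact el_rot (e := .crossUnder) hj hm' h2
  · exact el_rot (e := .crossOver) hj hm' h2

theorem cr_rot_rot {i m : ℕ} (b : Bool) (hm : i + 2 = m) (h1 : i + 2 ≤ m) (h2 : 0 + 2 ≤ m)
    (hm' : 0 < m) :
    (cr b i h1 : pt q m ⟶ pt q m) ≫ rot hm' ≫ rot hm' = rot hm' ≫ rot hm' ≫ cr b 0 h2 := by
  cases b
  · exact cross_rot_rot (.inr rfl) hm h2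
  · exact cross_rot_rot (.inl rfl) hm h2

theorem cu_cr_cr {i j m n : ℕ} (b : Bool) (hj : j = i + 1) (h1 : i ≤ m) (h2 : n = m + 2)
    (h3 : j + 2 ≤ n) (h5 : j ≤ m) (h6 : i + 2 ≤ n) :
    (cu i h1 h2 : pt q m ⟶ pt q n) ≫ cr b j h3 ≫ cr b i h6 = cu j h5 h2 := by
  rw [reassoc_of% cu_cr b hj h1 h2 h3 h5 h6, cr_cancel', Category.comp_id]

theorem cr_cr_ca {i j m n : ℕ} (b : Bool) (hj : j = i + 1) (h1 : i + 2 ≤ m) (h2 : n + 2 = m)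
    (h3 : j + 2 ≤ m) :
    (cr b j h3 : pt q m ⟶ pt q m) ≫ cr b i h1 ≫ (ca j h3 h2 : pt q m ⟶ pt q n) = ca i h1 h2 := by
  have := cr_ca (q := q) (!b) hj h1 h2 h3 h1
  rw [Bool.not_not] at this
  rw [← this, ← Category.assoc, cr_cancel, Category.id_comp]

theorem cu_cr_cr' {i j m n : ℕ} (b : Bool) (hj : j = i + 1) (h1 : i ≤ m) (h2 : n = m + 2)
    (h3 : j + 2 ≤ n) (h5 : j ≤ m) (h6 : i + 2 ≤ n) :
    (cu j h5 h2 : pt q m ⟶ pt q n) ≫ cr b i h6 ≫ cr b j h3 = cu i h1 h2 := by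
  have := cu_cr (q := q) (!b) hj h1 h2 h3 h5 h6
  rw [Bool.not_not] at this
  rw [← reassoc_of% this, cr_cancel', Category.comp_id]

theorem cr_cr_ca' {i j m n : ℕ} (b : Bool) (hj : j = i + 1) (h1 : i + 2 ≤ m) (h2 : n + 2 = m)
    (h3 : j + 2 ≤ m) :
    (cr b i h1 : pt q m ⟶ pt q m) ≫ cr b j h3 ≫ (ca i h1 h2 : pt q m ⟶ pt q n) = ca j h3 h2 := by
  rw [cr_ca b hj h1 h2 h3 h1, ← Category.assoc, cr_cancel, Category.id_comp]

theorem cr_cr_cr {i j m : ℕ} (b b' : Bool) (hj : j = i + 1) (h1 : i + 2 ≤ m) (h2 : j + 2 ≤ m) :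
    (cr b' i h1 : pt q m ⟶ pt q m) ≫ cr b j h2 ≫ cr b i h1 = cr b j h2 ≫ cr b i h1 ≫ cr b' j h2 := by
  obtain ⟨n, rfl⟩ : ∃ n, m = n + 2 := ⟨m - 2, by omega⟩
  obtain ⟨x, y, hxy⟩ := cr_eq (q := q) b'
  rw [hxy h1 rfl, hxy h2 rfl]
  simp only [Preadditive.add_comp, Preadditive.comp_add, Linear.smul_comp, Linear.comp_smul,
    Category.id_comp, Category.comp_id, Category.assoc]
  rw [cu_cr_cr b hj _ _ _ (by omega), reassoc_of% cr_cr_ca b hj]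

theorem cr_cr_cr' {i j m : ℕ} (b b' : Bool) (hj : j = i + 1) (h1 : i + 2 ≤ m) (h2 : j + 2 ≤ m) :
    (cr b' j h2 : pt q m ⟶ pt q m) ≫ cr b i h1 ≫ cr b j h2 = cr b i h1 ≫ cr b j h2 ≫ cr b' i h1 := by
  obtain ⟨n, rfl⟩ : ∃ n, m = n + 2 := ⟨m - 2, by omega⟩
  obtain ⟨x, y, hxy⟩ := cr_eq (q := q) b'
  rw [hxy h1 rfl, hxy h2 rfl]
  simp only [Preadditive.add_comp, Preadditive.comp_add, Linear.smul_comp, Linear.comp_smul,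
    Category.id_comp, Category.comp_id, Category.assoc]
  rw [cu_cr_cr' b hj (by omega), reassoc_of% cr_cr_ca' b hj]

end Skein

open Skein

/-- The data of an endofunctor of the skein category that adds radial strands to a diagram, `before`
strands in front of the point `0` and `after` strands behind the last point. The elementary pieces
just move to the new positions; the diagrams that replace `rot` and `rotInv` are part of the data,
with the relations that they have to satisfy. -/
structure Placement (q : ℂˣ) where
  obj : ℕ → ℕ
  before : ℕ
  after : ℕ
  obj_eq (m : ℕ) : obj m = before + m + after
  rot {m : ℕ} (hm : 0 < m) : pt q (obj m) ⟶ pt q (obj m)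
  rotInv {m : ℕ} (hm : 0 < m) : pt q (obj m) ⟶ pt q (obj m)
  rot_rotInv {m : ℕ} (hm : 0 < m) : rot hm ≫ rotInv hm = 𝟙 _
  rotInv_rot {m : ℕ} (hm : 0 < m) : rotInv hm ≫ rot hm = 𝟙 _
  el_rot (e : Piece) {i m n : ℕ} (hi : i + 1 + e.inn ≤ m) (hn : n + e.inn = m + e.out)
    (hm' : 0 < m) (hn' : 0 < n) (h : before + i + e.inn ≤ obj m)
    (h' : before + i + 1 + e.inn ≤ obj m) (h'' : obj n + e.inn = obj m + e.out) :
    el e (before + i) h h'' ≫ rot hn' = rot hm' ≫ el e (before + i + 1) h' h''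
  cup_rot_rot {m n : ℕ} (hn : n = m + 2) (hn' : 0 < n) (h : before + m ≤ obj m)
    (h' : before ≤ obj m) (h'' : obj n = obj m + 2) :
    cu (before + m) h h'' ≫ rot hn' ≫ rot hn' = cu before h' h''
  rot_rot_cap {m n : ℕ} (hn : n + 2 = m) (hm' : 0 < m) (h : before + 2 ≤ obj m)
    (h' : before + n + 2 ≤ obj m) (h'' : obj n + 2 = obj m) :
    rot hm' ≫ rot hm' ≫ ca before h h'' = ca (before + n) h' h''

namespace Placement

variable {q : ℂˣ} (P : Placement q)

theorem le_obj {i m : ℕ} {e : Piece} (hi : i + e.inn ≤ m) : P.before + i + e.inn ≤ P.obj m := by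
  rw [P.obj_eq]; omega

theorem obj_obj {m n : ℕ} {e : Piece} (hn : n + e.inn = m + e.out) :
    P.obj n + e.inn = P.obj m + e.out := by
  rw [P.obj_eq, P.obj_eq]; omega

/-- The image of a slice. -/
noncomputable def slice : {m n : ℕ} → Slice m n → (pt q (P.obj m) ⟶ pt q (P.obj n))
  | _, _, .piece e i hi hn => el e (P.before + i) (P.le_obj hi) (P.obj_obj hn)
  | _, _, .rot hm => P.rot hm
  | _, _, .rotInv hm => P.rotInv hm

/-- The functor on diagrams. -/
noncomputable def diagramFunctor : Diagram ⥤ Skein q :=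
  Paths.lift { obj := fun c => pt q (P.obj c.pts), map := fun s => P.slice s }

/-- The image of a diagram. -/
noncomputable def onDiagram {m n : ℕ} (D : Diagram.pt m ⟶ Diagram.pt n) :
    pt q (P.obj m) ⟶ pt q (P.obj n) := P.diagramFunctor.map D

theorem onDiagram_ofSlice {m n : ℕ} (s : Slice m n) :
    P.onDiagram (Diagram.ofSlice s) = P.slice s :=
  Paths.lift_toPath (V := Circle) _ (X := ⟨m⟩) (Y := ⟨n⟩) s

theorem onDiagram_comp {m n k : ℕ} (D : Diagram.pt m ⟶ Diagram.pt n)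
    (D' : Diagram.pt n ⟶ Diagram.pt k) :
    P.onDiagram (D ≫ D') = P.onDiagram D ≫ P.onDiagram D' := P.diagramFunctor.map_comp D D'

theorem onDiagram_id (m : ℕ) : P.onDiagram (𝟙 (Diagram.pt m)) = 𝟙 _ := P.diagramFunctor.map_id _

theorem onDiagram_piece {m n : ℕ} (e : Piece) (i : ℕ) (hi : i + e.inn ≤ m)
    (hn : n + e.inn = m + e.out) : P.onDiagram (Diagram.piece e i hi hn) =
      el e (P.before + i) (P.le_obj hi) (P.obj_obj hn) := P.onDiagram_ofSlice _

theorem onDiagram_crossOver {m : ℕ} (i : ℕ) (hi : i + 2 ≤ m) :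
    P.onDiagram (Diagram.crossOver i hi) =
      cr true (P.before + i) (P.le_obj (e := .crossOver) hi) := P.onDiagram_ofSlice _

theorem onDiagram_crossUnder {m : ℕ} (i : ℕ) (hi : i + 2 ≤ m) :
    P.onDiagram (Diagram.crossUnder i hi) =
      cr false (P.before + i) (P.le_obj (e := .crossUnder) hi) := P.onDiagram_ofSlice _

theorem onDiagram_cup {m n : ℕ} (i : ℕ) (hi : i ≤ m) (hn : n = m + 2) :
    P.onDiagram (Diagram.cup i hi hn) =
      cu (P.before + i) (P.le_obj (e := .cup) hi) (P.obj_obj (e := .cup) hn) :=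
  P.onDiagram_ofSlice _

theorem onDiagram_cap {m n : ℕ} (i : ℕ) (hi : i + 2 ≤ m) (hn : n + 2 = m) :
    P.onDiagram (Diagram.cap i hi hn) =
      ca (P.before + i) (P.le_obj (e := .cap) hi) (P.obj_obj (e := .cap) hn) :=
  P.onDiagram_ofSlice _

theorem onDiagram_rot {m : ℕ} (hm : 0 < m) : P.onDiagram (Diagram.rot hm) = P.rot hm :=
  P.onDiagram_ofSlice _

theorem onDiagram_rotInv {m : ℕ} (hm : 0 < m) : P.onDiagram (Diagram.rotInv hm) = P.rotInv hm :=
  P.onDiagram_ofSlice _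

theorem cross_rot_rot (b : Bool) {i m : ℕ} (hm : i + 2 = m) (hm' : 0 < m)
    (h : P.before + i + 2 ≤ P.obj m) (h' : P.before + 2 ≤ P.obj m) :
    cr b (P.before + i) h ≫ P.rot hm' ≫ P.rot hm' = P.rot hm' ≫ P.rot hm' ≫ cr b P.before h' := by
  obtain ⟨x, y, hxy⟩ := cr_eq (q := q) b
  have h1 := P.obj_eq m
  have h2 := P.obj_eq i
  rw [hxy h (n := P.obj i) (by omega), hxy h' (n := P.obj i) (by omega)]
  simp only [Preadditive.add_comp, Preadditive.comp_add, Linear.smul_comp, Linear.comp_smul,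
    Category.id_comp, Category.comp_id, Category.assoc]
  rw [P.cup_rot_rot hm.symm hm' (by omega) (by omega),
    reassoc_of% P.rot_rot_cap hm hm' h' h (by omega)]

theorem respects_iso ⦃X Y : Diagram⦄ (D D' : X ⟶ Y) (h : PlanarIsotopy D D') :
    P.diagramFunctor.map D = P.diagramFunctor.map D' := by
  induction h with
  | far e f hij hj h1 h2 h3 h4 h5 h6 h7 h8 =>
    change P.onDiagram (_ ≫ _) = P.onDiagram (_ ≫ _)
    simp only [onDiagram_comp, onDiagram_piece]
    exact far (by omega) (by omega)
  | zigzag_left hi hn =>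
    change P.onDiagram (_ ≫ _) = P.onDiagram (𝟙 _)
    simp only [onDiagram_comp, onDiagram_cup, onDiagram_cap, onDiagram_id]
    exact cu_ca_left rfl ..
  | zigzag_right hi hn =>
    change P.onDiagram (_ ≫ _) = P.onDiagram (𝟙 _)
    simp only [onDiagram_comp, onDiagram_cup, onDiagram_cap, onDiagram_id]
    exact cu_ca_right rfl ..
  | over_cap hi hn =>
    change P.onDiagram (_ ≫ _) = P.onDiagram (_ ≫ _)
    simp only [onDiagram_comp, onDiagram_crossOver, onDiagram_crossUnder, onDiagram_cap]
    exact cr_ca true rfl ..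
  | under_cap hi hn =>
    change P.onDiagram (_ ≫ _) = P.onDiagram (_ ≫ _)
    simp only [onDiagram_comp, onDiagram_crossOver, onDiagram_crossUnder, onDiagram_cap]
    exact cr_ca false rfl ..
  | cup_over hi hn =>
    change P.onDiagram (_ ≫ _) = P.onDiagram (_ ≫ _)
    simp only [onDiagram_comp, onDiagram_crossOver, onDiagram_crossUnder, onDiagram_cup]
    exact cu_cr true rfl ..
  | cup_under hi hn =>
    change P.onDiagram (_ ≫ _) = P.onDiagram (_ ≫ _)
    simp only [onDiagram_comp, onDiagram_crossOver, onDiagram_crossUnder, onDiagram_cup]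
    exact cu_cr false rfl ..
  | rot_rotInv hm =>
    change P.onDiagram (_ ≫ _) = P.onDiagram (𝟙 _)
    simp only [onDiagram_comp, onDiagram_rot, onDiagram_rotInv, onDiagram_id]
    exact P.rot_rotInv hm
  | rotInv_rot hm =>
    change P.onDiagram (_ ≫ _) = P.onDiagram (𝟙 _)
    simp only [onDiagram_comp, onDiagram_rot, onDiagram_rotInv, onDiagram_id]
    exact P.rotInv_rot hm
  | piece_rot e hi hn hm' hn' =>
    change P.onDiagram (_ ≫ _) = P.onDiagram (_ ≫ _)
    simp only [onDiagram_comp, onDiagram_rot, onDiagram_piece]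
    exact P.el_rot e hi hn hm' hn' ..
  | cup_rot_rot hn =>
    change P.onDiagram (_ ≫ _ ≫ _) = P.onDiagram _
    simp only [onDiagram_comp, onDiagram_rot, onDiagram_cup]
    exact P.cup_rot_rot hn ..
  | rot_rot_cap hn =>
    change P.onDiagram (_ ≫ _ ≫ _) = P.onDiagram _
    simp only [onDiagram_comp, onDiagram_rot, onDiagram_cap]
    exact P.rot_rot_cap hn ..
  | over_rot_rot hm =>
    change P.onDiagram (_ ≫ _ ≫ _) = P.onDiagram (_ ≫ _ ≫ _)
    simp only [onDiagram_comp, onDiagram_rot, onDiagram_crossOver]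
    exact P.cross_rot_rot true hm ..
  | under_rot_rot hm =>
    change P.onDiagram (_ ≫ _ ≫ _) = P.onDiagram (_ ≫ _ ≫ _)
    simp only [onDiagram_comp, onDiagram_rot, onDiagram_crossUnder]
    exact P.cross_rot_rot false hm ..

theorem respects : Respects P.diagramFunctor where
  iso := P.respects_iso
  crossOver hi hn := ((P.onDiagram_crossOver _ hi).trans
    (over_eq (P.obj_obj (e := .cap) hn))).trans (congrArg₂ (· + ·) rfl (congrArg (_ • ·)
      (congrArg₂ (· ≫ ·) (P.onDiagram_cap _ hi hn) (P.onDiagram_cup _ _ hn.symm)).symm))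
  crossUnder hi hn := ((P.onDiagram_crossUnder _ hi).trans
    (under_eq (P.obj_obj (e := .cap) hn))).trans (congrArg₂ (· + ·) (congrArg (_ • ·)
      (congrArg₂ (· ≫ ·) (P.onDiagram_cap _ hi hn) (P.onDiagram_cup _ _ hn.symm)).symm) rfl)
  loop hi hn := (congrArg₂ (· ≫ ·) (P.onDiagram_cup _ hi hn) (P.onDiagram_cap _ _ hn.symm)).trans
    loop_eq

/-- The induced functor on the skein category. -/
noncomputable def functor : Skein q ⥤ Skein q := lift P.diagramFunctor P.respects

/-- The induced functor on the skein category, as a linear map on morphisms. -/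
noncomputable def map {m n : ℕ} : (pt q m ⟶ pt q n) →ₗ[ℂ] (pt q (P.obj m) ⟶ pt q (P.obj n)) where
  toFun f := P.functor.map f
  map_add' _ _ := (lift P.diagramFunctor P.respects).map_add
  map_smul' _ _ := (lift P.diagramFunctor P.respects).map_smul _ _

theorem map_comp {m n k : ℕ} (f : pt q m ⟶ pt q n) (g : pt q n ⟶ pt q k) :
    P.map (f ≫ g) = P.map f ≫ P.map g := P.functor.map_comp f g

theorem map_id (m : ℕ) : P.map (𝟙 (pt q m)) = 𝟙 _ := P.functor.map_id _

theorem map_el {m n : ℕ} {e : Piece} {i : ℕ} (hi : i + e.inn ≤ m) (hn : n + e.inn = m + e.out) :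
    P.map (el e i hi hn) = el e (P.before + i) (P.le_obj hi) (P.obj_obj hn) :=
  (lift_map P.diagramFunctor P.respects _).trans (P.onDiagram_ofSlice _)

theorem map_rot {m : ℕ} (hm : 0 < m) : P.map (Skein.rot hm) = P.rot hm :=
  (lift_map P.diagramFunctor P.respects _).trans (P.onDiagram_ofSlice _)

theorem map_rotInv {m : ℕ} (hm : 0 < m) : P.map (Skein.rotInv hm) = P.rotInv hm :=
  (lift_map P.diagramFunctor P.respects _).trans (P.onDiagram_ofSlice _)

end Placement

namespace Skein

variable {q : ℂˣ}

/-- The strands `0, 1` pass, below, to the right of the `k` strands that follow. -/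
noncomputable def wrap {N : ℕ} (k : ℕ) (h : k + 2 ≤ N) : pt q N ⟶ pt q N :=
  climb (N := N) (cr false) 1 k (by omega) ≫ climb (N := N) (cr false) 0 k (by omega)

theorem wrap_succ {N : ℕ} (k : ℕ) (h : k + 1 + 2 ≤ N) :
    (wrap (k + 1) h : pt q N ⟶ pt q N) =
      wrap k (by omega) ≫ cr false (k + 1) (by omega) ≫ cr false k (by omega) := by
  have h1 : ∀ g, (cr false (1 + k) g : pt q N ⟶ pt q N) ≫ climb (N := N) (cr false) 0 k (by omega) =
      climb (N := N) (cr false) 0 k (by omega) ≫ cr false (k + 1) (by omega) := by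
    intro g
    rw [climb_comm (cr false) (cr false) (cr false (k + 1) (by omega)) 0 0 k (by omega) (by omega)]
    · simp only [Nat.add_comm 1 k]
    · intro j hj _ _
      exact cr_far false false (by omega) _ _
  simp only [wrap, climb, Category.assoc, Nat.zero_add]
  rw [reassoc_of% h1]

theorem cu_wrap {m N : ℕ} (k : ℕ) (h : k + 2 ≤ N) (h1 : 0 ≤ m) (h2 : N = m + 2) :
    (cu 0 h1 h2 : pt q m ⟶ pt q N) ≫ wrap k h = cu k (by omega) h2 := by
  induction k with
  | zero => simp [wrap, climb]
  | succ k ih =>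
    rw [wrap_succ, reassoc_of% ih (by omega)]
    exact cu_cr_cr false rfl ..

theorem wrap_ca {m N : ℕ} (k : ℕ) (h : k + 2 ≤ N) (h1 : 0 + 2 ≤ N) (h2 : m + 2 = N) :
    wrap k h ≫ (ca k h h2 : pt q N ⟶ pt q m) = ca 0 h1 h2 := by
  induction k with
  | zero => simp [wrap, climb]
  | succ k ih =>
    rw [wrap_succ, Category.assoc, Category.assoc, cr_cr_ca false rfl (by omega)]
    exact ih _

theorem climb_rot {N : ℕ} (b : Bool) (a a' k : ℕ) (ha : a' = a + 1) (h : a + k + 1 ≤ N)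
    (h' : a' + k + 1 ≤ N) (hN hN' : 0 < N) :
    climb (X := pt q N) (N := N) (cr b) a k h ≫ rot hN =
      rot hN' ≫ climb (N := N) (cr b) a' k h' :=
  climb_comm _ _ _ _ _ _ _ _ fun j hj g g' => cr_rot b (by omega) _ _ _ _

theorem climb_el_right {e : Piece} {N N' : ℕ} (b : Bool) (a k i : ℕ) (hi : a + k + 1 ≤ i)
    (h : a + k + 1 ≤ N) (h' : a + k + 1 ≤ N') (h1 : i + e.inn ≤ N) (h2 : N' + e.inn = N + e.out) :
    climb (N := N) (cr b) a k h ≫ (el e i h1 h2 : pt q N ⟶ pt q N') =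
      el e i h1 h2 ≫ climb (N := N') (cr b) a k h' :=
  climb_comm _ _ _ _ _ _ _ _ fun j hj g g' => cr_el b (by omega) ..

theorem climb_el_left {e : Piece} {N N' : ℕ} (b : Bool) (a a' k i : ℕ) (hi : i + e.inn ≤ a)
    (ha : a' + e.inn = a + e.out)
    (h : a + k + 1 ≤ N) (h' : a' + k + 1 ≤ N') (h1 : i + e.inn ≤ N) (h2 : N' + e.inn = N + e.out) :
    climb (N := N) (cr b) a k h ≫ (el e i h1 h2 : pt q N ⟶ pt q N') =
      el e i h1 h2 ≫ climb (N := N') (cr b) a' k h' :=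
  climb_comm _ _ _ _ _ _ _ _ fun j hj g g' => (el_cr b (by omega) (by omega) ..).symm

theorem climb_climb {N : ℕ} (b b' : Bool) (a k a' k' : ℕ) (ha : a + k + 1 ≤ a')
    (h : a + k + 1 ≤ N) (h' : a' + k' + 1 ≤ N) :
    climb (X := pt q N) (N := N) (cr b) a k h ≫ climb (N := N) (cr b') a' k' h' =
      climb (N := N) (cr b') a' k' h' ≫ climb (N := N) (cr b) a k h :=
  climb_comm _ _ _ _ _ _ _ _ fun j hj g g' =>
    (climb_comm _ _ _ _ _ _ _ _ fun i hi g g' => (cr_far b b' (by omega) _ _).symm).symm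

theorem climb_congr {N : ℕ} (b : Bool) {a a' k k' : ℕ} (ha : a = a') (hk : k = k')
    (h : a + k + 1 ≤ N) (h' : a' + k' + 1 ≤ N) :
    climb (X := pt q N) (N := N) (cr b) a k h = climb (N := N) (cr b) a' k' h' := by
  subst ha hk; rfl

theorem el_congr {m n : ℕ} (e : Piece) {i j : ℕ} (hij : i = j) (h1 : i + e.inn ≤ m)
    (h2 : j + e.inn ≤ m) (h3 : n + e.inn = m + e.out) :
    (el e i h1 h3 : pt q m ⟶ pt q n) = el e j h2 h3 := by
  subst hij; rfl

theorem cu_congr {m n : ℕ} {i j : ℕ} (hij : i = j) (h1 : i ≤ m) (h2 : j ≤ m) (h3 : n = m + 2) :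
    (cu i h1 h3 : pt q m ⟶ pt q n) = cu j h2 h3 := by
  subst hij; rfl

theorem ca_congr {m n : ℕ} {i j : ℕ} (hij : i = j) (h1 : i + 2 ≤ m) (h2 : j + 2 ≤ m)
    (h3 : n + 2 = m) : (ca i h1 h3 : pt q m ⟶ pt q n) = ca j h2 h3 := by
  subst hij; rfl

theorem el_climb_aux (e : Piece) {N N' : ℕ} (b : Bool) (a : ℕ) (h : a + e.inn + 1 ≤ N)
    (h' : a + e.out + 1 ≤ N') (h1 : a + 1 + e.inn ≤ N) (h2 : N' + e.inn = N + e.out) :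
    (el e (a + 1) h1 h2 : pt q N ⟶ pt q N') ≫ climb (N := N') (cr b) a e.out h' =
      climb (N := N) (cr b) a e.inn h ≫ el e a (by omega) h2 := by
  cases e with
  | cup =>
    simp only [Piece.inn, Piece.out, climb, Category.id_comp]
    exact cu_cr_cr' b rfl (by simp only [Piece.inn] at *; omega) ..
  | cap =>
    simp only [Piece.inn, Piece.out, climb, Category.id_comp, Category.comp_id, Category.assoc]
    exact (cr_cr_ca' b rfl ..).symm
  | crossOver =>
    obtain rfl : N' = N := h2.trans rfl |> Nat.add_right_cancel
    simp only [Piece.inn, Piece.out, climb, Category.id_comp, Category.assoc]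
    exact cr_cr_cr' b true rfl ..
  | crossUnder =>
    obtain rfl : N' = N := h2.trans rfl |> Nat.add_right_cancel
    simp only [Piece.inn, Piece.out, climb, Category.id_comp, Category.assoc]
    exact cr_cr_cr' b false rfl ..

theorem el_climb {e : Piece} {N N' : ℕ} (b : Bool) (a i k k' : ℕ) (hi : i + e.inn ≤ k)
    (hk : k' + e.inn = k + e.out) (h : a + k + 1 ≤ N) (h' : a + k' + 1 ≤ N')
    (h1 : a + i + 1 + e.inn ≤ N) (h2 : N' + e.inn = N + e.out) :
    (el e (a + i + 1) h1 h2 : pt q N ⟶ pt q N') ≫ climb (N := N') (cr b) a k' h' =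
      climb (N := N) (cr b) a k h ≫ el e (a + i) (by omega) h2 := by
  obtain ⟨r, rfl⟩ : ∃ r, k = (i + e.inn) + r := ⟨k - (i + e.inn), by omega⟩
  obtain rfl : k' = (i + e.out) + r := by omega
  rw [climb_add, climb_add, climb_add, climb_add]
  simp only [Category.assoc]
  rw [← reassoc_of% climb_el_right (q := q) (e := e) b a i (a + i + 1) (by omega) (by omega)
    (by omega) h1 h2, reassoc_of% el_climb_aux (q := q) e b (a + i) (by omega) (by omega) h1 h2,
    climb_el_left b (a + (i + e.inn)) (a + (i + e.out)) r (a + i) (by omega) (by omega)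
      (by omega) (by omega) (by omega) h2]

end Skein

open Skein

/-- Insertion of a radial strand under a diagram, behind the last point. A strand that runs through
the ray crosses over the new strand. -/
noncomputable abbrev insertStrand (q : ℂˣ) : Placement q where
  obj m := m + 1
  before := 0
  after := 1
  obj_eq m := by omega
  rot {m} hm := cr true (m - 1) (by omega) ≫ Skein.rot (Nat.succ_pos m)
  rotInv {m} hm := Skein.rotInv (Nat.succ_pos m) ≫ cr false (m - 1) (by omega)
  rot_rotInv hm := by
    simp only [Category.assoc]
    rw [reassoc_of% Skein.rot_rotInv (q := q)]
    exact cr_cancel true _ _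
  rotInv_rot hm := by
    simp only [Category.assoc]
    rw [reassoc_of% (over_under_cancel (q := q) _).2]
    exact Skein.rotInv_rot _
  el_rot e {i m n} hi hn hm' hn' h h' h'' := by
    rw [reassoc_of% el_cr (q := q) (e := e) true (j := m - 1) (by omega) (by omega) h h''
      (by omega) (by omega), Skein.el_rot (by omega) (by omega) h', Category.assoc]
  cup_rot_rot {m n} hn hn' h h' h'' := by
    subst hn
    simp only [Category.assoc]
    rw [reassoc_of% (cr_rot (q := q) true (i := m) (j := m + 2 - 1) (m := m + 2 + 1) rfl (by omega)
      (by omega) (by omega) (by omega)).symm,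
      cu_congr (Nat.zero_add m) h (by omega) h'',
      reassoc_of% cu_cr_cr (q := q) (n := m + 2 + 1) true (i := m) (j := m + 2 - 1) (by omega)
        (by omega) (by omega) (by omega) (by omega)]
    exact Skein.cup_rot_rot
  rot_rot_cap {m n} hn hm' h h' h'' := by
    subst hn
    simp only [Category.assoc]
    rw [reassoc_of% (cr_rot (q := q) true (i := n) (j := n + 2 - 1) (m := n + 2 + 1) rfl (by omega)
      (by omega) (by omega) (by omega)).symm, ca_congr (Nat.zero_add n) h' (by omega) h'']
    have h1 := Skein.rot_rot_cap (q := q) (m := n + 2 + 1) (n := n + 1) (h1 := h) (h2 := rfl)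
      (hm' := by omega)
    change _ = ca (n + 1) (by omega) (by omega) at h1
    change _ ≫ _ ≫ _ ≫ _ ≫ el .cap 0 _ _ = _
    rw [h1]
    exact cr_cr_ca true rfl (by omega) ..

/-- Insertion of `k` radial strands over a diagram, in front of the point `0`. A strand that runs
through the ray crosses under the `k` new strands. -/
noncomputable abbrev addStrands (q : ℂˣ) (k : ℕ) : Placement q where
  obj m := k + m
  before := k
  after := 0
  obj_eq m := by omega
  rot {m} hm := Skein.rot (by omega) ≫ climb (N := k + m) (cr false) 0 k (by omega)
  rotInv {m} hm := descend (N := k + m) (cr true) 0 k (by omega) ≫ Skein.rotInv (by omega)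
  rot_rotInv {m} hm := by
    simp only [Category.assoc]
    have h1 := climb_descend (X := pt q (k + m)) (N := k + m) (cr false) (cr true)
      (fun i h => (over_under_cancel h).2) 0 k (by omega)
    rw [reassoc_of% h1]
    exact Skein.rot_rotInv _
  rotInv_rot hm := by
    simp only [Category.assoc]
    rw [reassoc_of% Skein.rotInv_rot (q := q)]
    exact descend_climb _ _ (fun i h => cr_cancel true h h) ..
  el_rot e {i m n} hi hn hm' hn' h h' h'' := by
    rw [reassoc_of% Skein.el_rot (q := q) rfl (by omega) h', Category.assoc,
      climb_el_right false 0 k (k + i + 1) (by omega)]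
  cup_rot_rot {m n} hn hn' h h' h'' := by
    subst hn
    simp only [Category.assoc]
    rw [reassoc_of% climb_rot (q := q) (N := k + (m + 2)) false 0 1 k rfl (by omega) (by omega)
      (by omega) (by omega)]
    change cu (k + m) _ _ ≫ _ ≫ _ ≫ wrap k (by omega) = _
    have h1 := Skein.cup_rot_rot (q := q) (m := k + m) (n := k + (m + 2)) (h1 := h) (h2 := h'')
      (hn' := by omega)
    change cu (k + m) _ _ ≫ _ = cu 0 (by omega) _ at h1
    rw [reassoc_of% h1]
    exact cu_wrap k ..
  rot_rot_cap {m n} hn hm' h h' h'' := by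
    subst hn
    simp only [Category.assoc]
    rw [reassoc_of% climb_rot (q := q) (N := k + (n + 2)) false 0 1 k rfl (by omega) (by omega)
      (by omega) (by omega)]
    have h1 := wrap_ca (q := q) (m := k + n) (N := k + (n + 2)) k h (by omega) h''
    rw [wrap, Category.assoc] at h1
    rw [h1]
    exact Skein.rot_rot_cap

namespace Skein

variable {q : ℂˣ}

/-- The arc insertion functor `f ↦ f × Id_1` on morphisms. -/
noncomputable def insertArc {k l : ℕ} :
    (pt q k ⟶ pt q l) →ₗ[ℂ] (pt q (k + 1) ⟶ pt q (l + 1)) := (insertStrand q).map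

/-- `f ↦ Id_k × f`: the diagram is put under `k` radial strands, whose points come first. -/
noncomputable def idTimes (k : ℕ) {m n : ℕ} :
    (pt q m ⟶ pt q n) →ₗ[ℂ] (pt q (k + m) ⟶ pt q (k + n)) := (addStrands q k).map

/-- `f ↦ f × Id_n`: the diagram is put on top of `n` radial strands, whose points come last. -/
noncomputable def timesId : (n : ℕ) → {k l : ℕ} →
    (pt q k ⟶ pt q l) →ₗ[ℂ] (pt q (k + n) ⟶ pt q (l + n))
  | 0, _, _ => LinearMap.id
  | n + 1, _, _ => insertArc ∘ₗ timesId n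

theorem insertArc_comp {k l r : ℕ} (f : pt q k ⟶ pt q l) (g : pt q l ⟶ pt q r) :
    insertArc (f ≫ g) = insertArc f ≫ insertArc g := Placement.map_comp ..

theorem insertArc_id (k : ℕ) : insertArc (𝟙 (pt q k)) = 𝟙 (pt q (k + 1)) := Placement.map_id ..

theorem insertArc_el {k l : ℕ} {e : Piece} {i : ℕ} (hi : i + e.inn ≤ k)
    (hn : l + e.inn = k + e.out) : insertArc (el e i hi hn : pt q k ⟶ pt q l) =
      el e i (by omega) (by omega) :=
  (Placement.map_el ..).trans (el_congr e (Nat.zero_add i) ..)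

theorem insertArc_cr {k : ℕ} (b : Bool) {i : ℕ} (hi : i + 2 ≤ k) :
    insertArc (cr b i hi : pt q k ⟶ pt q k) = cr b i (by omega) := by
  cases b
  · exact insertArc_el (e := .crossUnder) ..
  · exact insertArc_el (e := .crossOver) ..

theorem insertArc_rot {k : ℕ} (hm : 0 < k) : insertArc (rot hm : pt q k ⟶ pt q k) =
    cr true (k - 1) (by omega) ≫ rot (Nat.succ_pos k) := Placement.map_rot ..

theorem insertArc_rotInv {k : ℕ} (hm : 0 < k) : insertArc (rotInv hm : pt q k ⟶ pt q k) =
    rotInv (Nat.succ_pos k) ≫ cr false (k - 1) (by omega) := Placement.map_rotInv ..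

theorem insertArc_climb {N : ℕ} (b : Bool) (a k : ℕ) (h : a + k + 1 ≤ N) :
    insertArc (climb (X := pt q N) (N := N) (cr b) a k h) =
      climb (X := pt q (N + 1)) (N := N + 1) (cr b) a k (by omega) := by
  induction k with
  | zero => exact insertArc_id _
  | succ k ih => simp only [climb, insertArc_comp, ih, insertArc_cr]

theorem timesId_comp (n : ℕ) {k l r : ℕ} (f : pt q k ⟶ pt q l) (g : pt q l ⟶ pt q r) :
    timesId n (f ≫ g) = timesId n f ≫ timesId n g := by
  induction n with
  | zero => rfl
  | succ n ih =>
    simp only [timesId, LinearMap.comp_apply, ih]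
    exact insertArc_comp ..

theorem timesId_id (n k : ℕ) : timesId n (𝟙 (pt q k)) = 𝟙 (pt q (k + n)) := by
  induction n with
  | zero => rfl
  | succ n ih =>
    simp only [timesId, LinearMap.comp_apply, ih]
    exact insertArc_id ..

theorem timesId_el (n : ℕ) {k l : ℕ} {e : Piece} {i : ℕ} (hi : i + e.inn ≤ k)
    (hn : l + e.inn = k + e.out) : timesId n (el e i hi hn : pt q k ⟶ pt q l) =
      el e i (by omega) (by omega) := by
  induction n with
  | zero => rfl
  | succ n ih =>
    simp only [timesId, LinearMap.comp_apply, ih]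
    exact insertArc_el ..

theorem timesId_rot (n k : ℕ) (hm : 0 < k + 1) :
    timesId n (rot hm : pt q (k + 1) ⟶ pt q (k + 1)) =
      climb (X := pt q (k + 1 + n)) (N := k + 1 + n) (cr true) k n (by omega) ≫
        rot (by omega) := by
  induction n with
  | zero => exact (Category.id_comp _).symm
  | succ n ih =>
    simp only [timesId, LinearMap.comp_apply, ih, insertArc_comp, insertArc_rot, insertArc_climb]
    simp only [climb, Category.assoc]
    have h : k + 1 + n - 1 = k + n := by omega
    simp only [h]

theorem idTimes_comp (n : ℕ) {k l r : ℕ} (f : pt q k ⟶ pt q l) (g : pt q l ⟶ pt q r) :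
    idTimes n (f ≫ g) = idTimes n f ≫ idTimes n g := Placement.map_comp ..

theorem idTimes_id (n k : ℕ) : idTimes n (𝟙 (pt q k)) = 𝟙 (pt q (n + k)) := Placement.map_id ..

theorem idTimes_el (k : ℕ) {m n : ℕ} {e : Piece} {i : ℕ} (hi : i + e.inn ≤ m)
    (hn : n + e.inn = m + e.out) : idTimes k (el e i hi hn : pt q m ⟶ pt q n) =
      el e (k + i) (by omega) (by omega) := Placement.map_el ..

theorem idTimes_rot (k : ℕ) {m : ℕ} (hm : 0 < m) : idTimes k (rot hm : pt q m ⟶ pt q m) =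
    rot (by omega) ≫ climb (X := pt q (k + m)) (N := k + m) (cr false) 0 k (by omega) :=
  Placement.map_rot ..

theorem climb_comp_succ {N : ℕ} (b : Bool) (a k : ℕ) (h : a + (k + 1) + 1 ≤ N) :
    climb (X := pt q N) (N := N) (cr b) a (k + 1) h =
      cr b a (by omega) ≫ climb (N := N) (cr b) (a + 1) k (by omega) := by
  have h1 := climb_add (X := pt q N) (N := N) (cr b) a 1 k (by omega)
  rw [climb_congr b rfl (Nat.add_comm k 1) h (by omega), h1]
  simp [climb]

theorem rot_climb_climb_rot {N : ℕ} (m k : ℕ) (hN : k + m + 2 = N) (h0 : 0 < N)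
    (h1 : 0 + (k + 1) + 1 ≤ N) (h2 : k + (m + 1) + 1 ≤ N) :
    (rot h0 ≫ climb (X := pt q N) (N := N) (cr false) 0 (k + 1) h1) ≫
      climb (N := N) (cr true) k (m + 1) h2 ≫ rot h0 =
    (climb (X := pt q N) (N := N) (cr true) k (m + 1) h2 ≫ rot h0) ≫
      rot h0 ≫ climb (N := N) (cr false) 0 (k + 1) h1 := by
  simp only [Category.assoc]
  have e1 : climb (X := pt q N) (N := N) (cr false) 0 (k + 1) h1 =
      climb (N := N) (cr false) 0 k (by omega) ≫ cr false k (by omega) := by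
    simp only [climb, Nat.zero_add]
  have e2 : climb (X := pt q N) (N := N) (cr true) k (m + 1) h2 =
      climb (N := N) (cr true) k m (by omega) ≫ cr true (k + m) (by omega) := rfl
  have e3 : climb (X := pt q N) (N := N) (cr false) 0 (k + 1) h1 ≫
      climb (N := N) (cr true) k (m + 1) h2 =
      climb (N := N) (cr false) 0 k (by omega) ≫ climb (N := N) (cr true) (k + 1) m (by omega) := by
    rw [e1, climb_comp_succ true k m, Category.assoc, reassoc_of% (over_under_cancel (q := q) _).2]
  rw [reassoc_of% e3, e2, climb_comp_succ false 0 k]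
  simp only [Category.assoc]
  rw [reassoc_of% cr_rot_rot (q := q) (i := k + m) (m := N) true hN (by omega) (by omega) h0,
    reassoc_of% (over_under_cancel (q := q) _).1,
    ← climb_rot (N := N) false 0 (0 + 1) k rfl (by omega) (by omega) h0 h0,
    reassoc_of% climb_rot (q := q) (N := N) true k (k + 1) m rfl (by omega) (by omega) h0 h0,
    reassoc_of% climb_climb (q := q) (N := N) false true 0 k (k + 1) m (by omega)]

theorem interchange_rot_rot (m k : ℕ) (hm : 0 < m + 1) (hk : 0 < k + 1) :
    idTimes (k + 1) (rot hm : pt q (m + 1) ⟶ pt q (m + 1)) ≫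
      timesId (m + 1) (rot hk : pt q (k + 1) ⟶ pt q (k + 1)) =
    timesId (m + 1) (rot hk) ≫ idTimes (k + 1) (rot hm) := by
  rw [idTimes_rot, timesId_rot]
  exact rot_climb_climb_rot m k (by omega) ..

/-- The interchange law `(Y × Id) ∘ (Id × Z) = (Id × Z) ∘ (Y × Id)`. -/
def Comm {m n k l : ℕ} (Z : pt q m ⟶ pt q n) (Y : pt q k ⟶ pt q l) : Prop :=
  idTimes k Z ≫ timesId n Y = timesId m Y ≫ idTimes l Z

theorem comm_id_left {m k l : ℕ} (Y : pt q k ⟶ pt q l) : Comm (𝟙 (pt q m)) Y := by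
  simp [Comm, idTimes_id]

theorem comm_id_right {m n k : ℕ} (Z : pt q m ⟶ pt q n) : Comm Z (𝟙 (pt q k)) := by
  simp [Comm, timesId_id]

theorem Comm.comp_left {m n r k l : ℕ} {Z : pt q m ⟶ pt q n} {Z' : pt q n ⟶ pt q r}
    {Y : pt q k ⟶ pt q l} (h : Comm Z Y) (h' : Comm Z' Y) : Comm (Z ≫ Z') Y := by
  unfold Comm at *
  rw [idTimes_comp, idTimes_comp, Category.assoc, h', ← Category.assoc, h, Category.assoc]

theorem Comm.comp_right {m n r k l : ℕ} {Z : pt q m ⟶ pt q n} {Y : pt q k ⟶ pt q l}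
    {Y' : pt q l ⟶ pt q r} (h : Comm Z Y) (h' : Comm Z Y') : Comm Z (Y ≫ Y') := by
  unfold Comm at *
  rw [timesId_comp, timesId_comp, Category.assoc, ← h', ← Category.assoc, h, Category.assoc]

theorem Comm.inv_left {m k l : ℕ} {Z Z' : pt q m ⟶ pt q m}
    {Y : pt q k ⟶ pt q l} (h : Comm Z Y) (h1 : Z ≫ Z' = 𝟙 _) (h2 : Z' ≫ Z = 𝟙 _) : Comm Z' Y := by
  unfold Comm at *
  have h3 : idTimes k Z' ≫ (idTimes k Z ≫ timesId m Y) ≫ idTimes l Z' =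
    idTimes k Z' ≫ (timesId m Y ≫ idTimes l Z) ≫ idTimes l Z' := by rw [h]
  simp only [Category.assoc, ← idTimes_comp, h1, idTimes_id, Category.comp_id] at h3
  rw [← Category.assoc, ← idTimes_comp, h2, idTimes_id, Category.id_comp] at h3
  exact h3.symm

theorem Comm.inv_right {m n k : ℕ} {Z : pt q m ⟶ pt q n} {Y Y' : pt q k ⟶ pt q k}
    (h : Comm Z Y) (h1 : Y ≫ Y' = 𝟙 _) (h2 : Y' ≫ Y = 𝟙 _) : Comm Z Y' := by
  unfold Comm at *
  have h3 : timesId m Y' ≫ (idTimes k Z ≫ timesId n Y) ≫ timesId n Y' =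
    timesId m Y' ≫ (timesId m Y ≫ idTimes k Z) ≫ timesId n Y' := by rw [h]
  simp only [Category.assoc, ← timesId_comp, h1, timesId_id, Category.comp_id] at h3
  rw [← Category.assoc (timesId m Y'), ← timesId_comp, h2, timesId_id, Category.id_comp] at h3
  exact h3.symm

theorem comm_el_el {m n k l : ℕ} (e f : Piece) (i j : ℕ) (h1 : i + e.inn ≤ m)
    (h2 : n + e.inn = m + e.out) (h3 : j + f.inn ≤ k) (h4 : l + f.inn = k + f.out) :
    Comm (el e i h1 h2 : pt q m ⟶ pt q n) (el f j h3 h4 : pt q k ⟶ pt q l) := by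
  unfold Comm
  simp only [idTimes_el, timesId_el]
  exact (far (by omega) (by omega)).symm

theorem comm_el_rot {m n k : ℕ} (e : Piece) (i : ℕ) (h1 : i + e.inn ≤ m)
    (h2 : n + e.inn = m + e.out) (hk : 0 < k) :
    Comm (el e i h1 h2 : pt q m ⟶ pt q n) (rot hk : pt q k ⟶ pt q k) := by
  obtain ⟨k, rfl⟩ : ∃ k', k = k' + 1 := ⟨k - 1, by omega⟩
  unfold Comm
  simp only [idTimes_el, timesId_rot, Category.assoc]
  rw [el_congr e (i := k + 1 + i) (j := k + i + 1) (by omega) _ (by omega),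
    reassoc_of% el_climb (q := q) (e := e) (N := k + 1 + m) (N' := k + 1 + n) true k i m n
      (by omega) (by omega) (by omega) (by omega) (by omega) (by omega),
    el_rot (j := k + 1 + i) (by omega) (by omega) (by omega)]
  rw [el_congr e (i := k + i + 1) (j := k + 1 + i) (by omega) _ (by omega)]

theorem comm_rot_el {m k l : ℕ} (e : Piece) (i : ℕ) (h1 : i + e.inn ≤ k)
    (h2 : l + e.inn = k + e.out) (hm : 0 < m) :
    Comm (rot hm : pt q m ⟶ pt q m) (el e i h1 h2 : pt q k ⟶ pt q l) := by
  unfold Comm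
  simp only [idTimes_rot, timesId_el, Category.assoc]
  rw [reassoc_of% el_rot (q := q) (e := e) (i := i) (m := k + m) (n := l + m) rfl (by omega)
    (by omega)]
  have h3 := el_climb (q := q) (e := e) (N := k + m) (N' := l + m) false 0 i k l
      (by omega) (by omega) (by omega) (by omega) (by omega) (by omega)
  simp only [Nat.zero_add] at h3
  rw [h3]

theorem comm_rot_rot {m k : ℕ} (hm : 0 < m) (hk : 0 < k) :
    Comm (rot hm : pt q m ⟶ pt q m) (rot hk : pt q k ⟶ pt q k) := by
  obtain ⟨k, rfl⟩ : ∃ k', k = k' + 1 := ⟨k - 1, by omega⟩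
  obtain ⟨m, rfl⟩ : ∃ m', m = m' + 1 := ⟨m - 1, by omega⟩
  exact interchange_rot_rot m k hm hk

theorem comm_el {m n k l : ℕ} (e : Piece) (i : ℕ) (h1 : i + e.inn ≤ m)
    (h2 : n + e.inn = m + e.out) (D : Diagram.pt k ⟶ Diagram.pt l) :
    Comm (el e i h1 h2 : pt q m ⟶ pt q n) ((toSkein q).map D) :=
  word_ind (fun Y => Comm (el e i h1 h2 : pt q m ⟶ pt q n) Y) (fun _ => comm_id_right _)
    (fun _ _ h h' => h.comp_right h') (fun f j h3 h4 => comm_el_el e f i j h1 h2 h3 h4)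
    (fun hm => comm_el_rot e i h1 h2 hm)
    (fun hm => (comm_el_rot e i h1 h2 hm).inv_right (rot_rotInv hm) (rotInv_rot hm)) D

theorem comm_rot {m k l : ℕ} (hm : 0 < m) (D : Diagram.pt k ⟶ Diagram.pt l) :
    Comm (rot hm : pt q m ⟶ pt q m) ((toSkein q).map D) :=
  word_ind (fun Y => Comm (rot hm : pt q m ⟶ pt q m) Y) (fun _ => comm_id_right _)
    (fun _ _ h h' => h.comp_right h') (fun f j h3 h4 => comm_rot_el f j h3 h4 hm)
    (fun hk => comm_rot_rot hm hk)
    (fun hk => (comm_rot_rot hm hk).inv_right (rot_rotInv hk) (rotInv_rot hk)) D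

theorem comm_diagram {m n k l : ℕ} (D' : Diagram.pt m ⟶ Diagram.pt n)
    (D : Diagram.pt k ⟶ Diagram.pt l) :
    Comm ((toSkein q).map D') ((toSkein q).map D) :=
  word_ind (fun Z => Comm Z ((toSkein q).map D)) (fun _ => comm_id_left _)
    (fun _ _ h h' => h.comp_left h') (fun e i h1 h2 => comm_el e i h1 h2 D)
    (fun hm => comm_rot hm D)
    (fun hm => (comm_rot hm D).inv_left (rot_rotInv hm) (rotInv_rot hm)) D'

theorem interchange {m n k l : ℕ} (Z : pt q m ⟶ pt q n) (Y : pt q k ⟶ pt q l) :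
    idTimes k Z ≫ timesId n Y = timesId m Y ≫ idTimes l Z := by
  refine ind (X := pt q m) (Y := pt q n)
    (fun Z => idTimes k Z ≫ timesId n Y = timesId m Y ≫ idTimes l Z) (fun D' => ?_) (by simp)
    (fun f g hf hg => by simp only [map_add, Preadditive.add_comp, Preadditive.comp_add, hf, hg])
    (fun c f hf => by simp only [map_smul, Linear.smul_comp, Linear.comp_smul, hf]) Z
  exact ind (X := pt q k) (Y := pt q l)
    (fun Y => idTimes k ((toSkein q).map D') ≫ timesId n Y =
      timesId m Y ≫ idTimes l ((toSkein q).map D')) (fun D => comm_diagram D' D) (by simp)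
    (fun f g hf hg => by simp only [map_add, Preadditive.add_comp, Preadditive.comp_add, hf, hg])
    (fun c f hf => by simp only [map_smul, Linear.smul_comp, Linear.comp_smul, hf]) Y

end Skein

section Modules

section Balanced

variable {A B N M P : Type*} [Ring A] [Ring B] [Algebra ℂ B] [AddCommGroup N] [Module ℂ N]
    [Module B N] [IsScalarTower ℂ B N] [AddCommGroup M] [Module ℂ M] [Module A M]
    [AddCommGroup P] [Module ℂ P] [Module B P] [IsScalarTower ℂ B P]

/-- The relations `n a ⊗ m = n ⊗ a m` of the tensor product `N ⊗_A M`, where `r a n = n a` is a right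
action of `A` on the left `B`-module `N` that commutes with `B`. The set of relations is stable
under `B`, so its `B`-span is its additive span. -/
def balancedRel (r : A → N → N) : Submodule B (N ⊗[ℂ] M) :=
  Submodule.span B {x | ∃ (a : A) (n : N) (m : M), x = r a n ⊗ₜ[ℂ] m - n ⊗ₜ[ℂ] (a • m)}

variable (B M)

/-- The tensor product `N ⊗_A M` of the `(B, A)`-bimodule `N` and the left `A`-module `M`, as a left
`B`-module. -/
def Balanced (r : A → N → N) : Type _ :=
  (N ⊗[ℂ] M) ⧸ (balancedRel r : Submodule B (N ⊗[ℂ] M))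

variable {B M}

instance (r : A → N → N) : AddCommGroup (Balanced B M r) :=
  inferInstanceAs (AddCommGroup ((N ⊗[ℂ] M) ⧸ (balancedRel r : Submodule B (N ⊗[ℂ] M))))

instance (r : A → N → N) : Module B (Balanced B M r) :=
  inferInstanceAs (Module B ((N ⊗[ℂ] M) ⧸ (balancedRel r : Submodule B (N ⊗[ℂ] M))))

instance (r : A → N → N) : Module ℂ (Balanced B M r) :=
  inferInstanceAs (Module ℂ ((N ⊗[ℂ] M) ⧸ (balancedRel r : Submodule B (N ⊗[ℂ] M))))

instance (r : A → N → N) : IsScalarTower ℂ B (Balanced B M r) :=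
  inferInstanceAs (IsScalarTower ℂ B ((N ⊗[ℂ] M) ⧸ (balancedRel r : Submodule B (N ⊗[ℂ] M))))

variable (B)

/-- The class of `n ⊗ m`. -/
def Balanced.mk (r : A → N → N) (n : N) (m : M) : Balanced B M r :=
  (balancedRel r).mkQ (n ⊗ₜ[ℂ] m)

variable {B}

theorem Balanced.mk_balanced (r : A → N → N) (a : A) (n : N) (m : M) :
    Balanced.mk B r (r a n) m = Balanced.mk B r n (a • m) :=
  (Submodule.Quotient.eq _).2 (Submodule.subset_span ⟨a, n, m, rfl⟩)

/-- The universal property of `N ⊗_A M`. -/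
def Balanced.lift (r : A → N → N) (g : N →ₗ[B] M →ₗ[ℂ] P)
    (hg : ∀ a n m, g (r a n) m = g n (a • m)) : Balanced B M r →ₗ[B] P :=
  (balancedRel r).liftQ (TensorProduct.AlgebraTensorModule.lift g) (by
    rw [balancedRel, Submodule.span_le]
    rintro _ ⟨a, n, m, rfl⟩
    simp [hg])

theorem Balanced.lift_mk (r : A → N → N) (g : N →ₗ[B] M →ₗ[ℂ] P)
    (hg : ∀ a n m, g (r a n) m = g n (a • m)) (n : N) (m : M) :
    Balanced.lift r g hg (Balanced.mk B r n m) = g n m := rfl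

variable (B M)

/-- The class of `n ⊗ m` as a function that is `B`-linear in `n` and `ℂ`-linear in `m`. -/
def Balanced.mkLin (r : A → N → N) : N →ₗ[B] M →ₗ[ℂ] Balanced B M r where
  toFun n :=
    { toFun := fun m => Balanced.mk B r n m
      map_add' := fun x y => (congrArg (balancedRel r).mkQ (TensorProduct.tmul_add n x y)).trans
        (map_add _ _ _)
      map_smul' := fun c x => congrArg (balancedRel r).mkQ (TensorProduct.tmul_smul c n x) }
  map_add' x y := LinearMap.ext fun m =>
    (congrArg (balancedRel r).mkQ (TensorProduct.add_tmul x y m)).trans (map_add _ _ _)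
  map_smul' _ _ := rfl

end Balanced

variable {A B : Type*} [Ring A] [Algebra ℂ A] [Ring B] [Algebra ℂ B]

/-- The induced module `B ⊗_A M`, where `A` acts on `B` from the right through `η`. -/
abbrev Ind (η : A →ₐ[ℂ] B) (M : Type*) [AddCommGroup M] [Module ℂ M] [Module A M] : Type _ :=
  Balanced B M (fun (a : A) (b : B) => b * η a)

/-- The restriction of a `B`-module along `η`. -/
def Res (_η : A →ₐ[ℂ] B) (N : Type*) : Type _ := N

instance (η : A →ₐ[ℂ] B) (N : Type*) [AddCommGroup N] : AddCommGroup (Res η N) :=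
  inferInstanceAs (AddCommGroup N)

instance (η : A →ₐ[ℂ] B) (N : Type*) [AddCommGroup N] [Module B N] : Module A (Res η N) :=
  Module.compHom N η.toRingHom

instance (η : A →ₐ[ℂ] B) (N : Type*) [AddCommGroup N] [Module ℂ N] : Module ℂ (Res η N) :=
  inferInstanceAs (Module ℂ N)

instance (η : A →ₐ[ℂ] B) (N : Type*) [AddCommGroup N] [Module ℂ N] [Module B N]
    [IsScalarTower ℂ B N] : IsScalarTower ℂ A (Res η N) where
  smul_assoc c a x := by
    change η (c • a) • (show N from x) = c • η a • (show N from x)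
    rw [map_smul, smul_assoc]

section Hat

variable (η : A →ₐ[ℂ] B) {M N : Type*} [AddCommGroup M] [Module ℂ M] [Module A M]
    [IsScalarTower ℂ A M] [AddCommGroup N] [Module ℂ N] [Module B N] [IsScalarTower ℂ B N]

/-- The underlying `ℂ`-linear map. -/
def resLin (f : M →ₗ[A] Res η N) : M →ₗ[ℂ] N where
  toFun m := f m
  map_add' x y := f.map_add x y
  map_smul' c x := by
    have h := f.map_smul (algebraMap ℂ A c) x
    rw [algebraMap_smul] at h
    refine h.trans ?_
    change (η (algebraMap ℂ A c)) • (show N from f x) = c • (show N from f x)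
    rw [AlgHom.commutes, algebraMap_smul]

theorem resLin_smul (f : M →ₗ[A] Res η N) (a : A) (m : M) :
    resLin η f (a • m) = η a • resLin η f m := f.map_smul a m

/-- The intertwiner `B ⊗_A M → N`, `b ⊗ m ↦ b f(m)`, induced by an intertwiner `f` from `M` to the
restriction of `N`. -/
def inducedMap (f : M →ₗ[A] Res η N) : Ind η M →ₗ[B] N :=
  Balanced.lift _
    { toFun := fun b => b • resLin η f
      map_add' := fun x y => add_smul x y _
      map_smul' := fun x y => mul_smul x y _ }
    (fun a b m => by
      change (b * η a) • resLin η f m = b • resLin η f (a • m)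
      rw [resLin_smul, mul_smul])

theorem inducedMap_mk (f : M →ₗ[A] Res η N) (b : B) (m : M) :
    inducedMap η f (Balanced.mk B _ b m) = b • resLin η f m := rfl

end Hat

/-- The vector space `M ⊗ N`, as a module over `A ⊗ B`. -/
def ExtTensor (_A _B : Type*) (M N : Type*) [AddCommGroup M] [Module ℂ M]
    [AddCommGroup N] [Module ℂ N] : Type _ := M ⊗[ℂ] N

section ExtTensor

variable {M N : Type*} [AddCommGroup M] [Module ℂ M] [Module A M] [IsScalarTower ℂ A M]
  [AddCommGroup N] [Module ℂ N] [Module B N] [IsScalarTower ℂ B N]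

noncomputable instance : AddCommGroup (ExtTensor A B M N) :=
  inferInstanceAs (AddCommGroup (M ⊗[ℂ] N))

noncomputable instance : Module ℂ (ExtTensor A B M N) :=
  inferInstanceAs (Module ℂ (M ⊗[ℂ] N))

variable (A B M N)

/-- The action of `A ⊗ B` on `M ⊗ N`: `(a ⊗ b) (m ⊗ n) = a m ⊗ b n`. -/
noncomputable def extAct : A ⊗[ℂ] B →ₐ[ℂ] Module.End ℂ (M ⊗[ℂ] N) :=
  Module.endTensorEndAlgHom.comp
    (Algebra.TensorProduct.map (Algebra.lsmul ℂ ℂ M) (Algebra.lsmul ℂ ℂ N))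

variable {A B M N}

noncomputable instance : Module (A ⊗[ℂ] B) (ExtTensor A B M N) :=
  Module.compHom (M ⊗[ℂ] N) (extAct A B M N).toRingHom

instance : IsScalarTower ℂ (A ⊗[ℂ] B) (ExtTensor A B M N) where
  smul_assoc c x y := by
    change extAct A B M N (c • x) y = c • extAct A B M N x y
    rw [map_smul]; rfl

variable (A B)

/-- The pure tensor `m ⊗ n`. -/
def ExtTensor.tmul (m : M) (n : N) : ExtTensor A B M N := m ⊗ₜ[ℂ] n

variable (M)

/-- The map `m ↦ m ⊗ w`. -/
def ExtTensor.tmulRight (w : N) : M →ₗ[ℂ] ExtTensor A B M N where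
  toFun m := ExtTensor.tmul A B m w
  map_add' _ _ := TensorProduct.add_tmul _ _ _
  map_smul' _ _ := rfl

variable {A B M}

theorem ExtTensor.smul_tmul (a : A) (b : B) (m : M) (n : N) :
    (a ⊗ₜ[ℂ] b) • ExtTensor.tmul A B m n = ExtTensor.tmul A B (a • m) (b • n) := rfl

end ExtTensor

/-- The one-dimensional module on which `A` acts through the character `χ`. -/
def CharModule (_χ : A →ₐ[ℂ] ℂ) : Type := ℂ

noncomputable instance (χ : A →ₐ[ℂ] ℂ) : AddCommGroup (CharModule χ) :=
  inferInstanceAs (AddCommGroup ℂ)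
noncomputable instance (χ : A →ₐ[ℂ] ℂ) : Module ℂ (CharModule χ) := inferInstanceAs (Module ℂ ℂ)
noncomputable instance (χ : A →ₐ[ℂ] ℂ) : Module A (CharModule χ) :=
  Module.compHom ℂ χ.toRingHom
end Modules

section Alg

variable {q : ℂˣ}

open Skein

instance (X Y : Skein q) : IsScalarTower ℂ (End Y) (X ⟶ Y) where
  smul_assoc c r f := Linear.comp_smul _ _ _ f c r

/-- The affine Temperley–Lieb algebra `TL_n`, realised as the endomorphism algebra of the object `n`
of the skein category. The product `f * g` is the composite `f ∘ g`. -/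
abbrev TL (q : ℂˣ) (n : ℕ) : Type := End (pt q n)

/-- The arc insertion algebra map `TL_n → TL_{n+1}`. -/
noncomputable def arcInsertion (q : ℂˣ) (n : ℕ) : TL q n →ₐ[ℂ] TL q (n + 1) :=
  AlgHom.ofLinearMap insertArc (insertArc_id n) (fun x y => insertArc_comp y x)

/-- The algebra map `Y ↦ Y × Id_n`. -/
noncomputable def timesIdAlg (q : ℂˣ) (m n : ℕ) : TL q m →ₐ[ℂ] TL q (m + n) :=
  AlgHom.ofLinearMap (timesId n) (timesId_id n m) (fun x y => timesId_comp n y x)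

/-- The algebra map `Z ↦ Id_m × Z`. -/
noncomputable def idTimesAlg (q : ℂˣ) (m n : ℕ) : TL q n →ₐ[ℂ] TL q (m + n) :=
  AlgHom.ofLinearMap (idTimes m) (idTimes_id m n) (fun x y => idTimes_comp m y x)

/-- The algebra map `TL_m ⊗ TL_n → TL_{m+n}`, `Y ⊗ Z ↦ Y × Z = (Y × Id_n) ∘ (Id_m × Z)`. -/
noncomputable def fusionHom (q : ℂˣ) (m n : ℕ) : TL q m ⊗[ℂ] TL q n →ₐ[ℂ] TL q (m + n) :=
  Algebra.TensorProduct.lift (timesIdAlg q m n) (idTimesAlg q m n)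
    (fun Y Z => interchange Z Y)

theorem fusionHom_tmul (m n : ℕ) (Y : TL q m) (Z : TL q n) :
    fusionHom q m n (Y ⊗ₜ Z) = (show TL q (m + n) from timesId n Y) * (show TL q (m + n) from idTimes m Z) := rfl

/-- The fusion product of a `TL_m`-module and a `TL_n`-module: the `TL_{m+n}`-module induced from
`M ⊗ N` along `TL_m ⊗ TL_n → TL_{m+n}`. -/
abbrev Fusion (q : ℂˣ) (m n : ℕ) (M N : Type) [AddCommGroup M] [Module ℂ M] [Module (TL q m) M]
    [IsScalarTower ℂ (TL q m) M] [AddCommGroup N] [Module ℂ N] [Module (TL q n) N]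
    [IsScalarTower ℂ (TL q n) N] : Type :=
  Ind (fusionHom q m n) (ExtTensor (TL q m) (TL q n) M N)

/-- The non-contractible loop, the generator of `TL_0`. -/
noncomputable def loop (q : ℂˣ) : pt q 0 ⟶ pt q 0 :=
  cu (n := 2) 0 le_rfl rfl ≫ rot (by omega) ≫ ca 0 le_rfl rfl

/-- The identification of `ℂ[X]` with `TL_0`. -/
noncomputable def ofPoly (q : ℂˣ) : ℂ[X] →ₐ[ℂ] TL q 0 := Polynomial.aeval (show TL q 0 from loop q)

/-- The Dehn twist of a radial strand, the generator of `TL_1`. -/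
noncomputable def twist (q : ℂˣ) : (TL q 1)ˣ where
  val := rot one_pos
  inv := rotInv one_pos
  val_inv := rotInv_rot _
  inv_val := rot_rotInv _

/-- The identification of `ℂ[T, T⁻¹]` with `TL_1`. -/
noncomputable def ofLaurent (q : ℂˣ) : ℂ[T;T⁻¹] →ₐ[ℂ] TL q 1 :=
  AddMonoidAlgebra.lift ℂ (TL q 1) ℤ ((Units.coeHom (TL q 1)).comp (zpowersHom _ (twist q)))

/-- The character `T ↦ v`. -/
noncomputable def evalT (v : ℂˣ) : ℂ[T;T⁻¹] →ₐ[ℂ] ℂ :=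
  AddMonoidAlgebra.lift ℂ ℂ ℤ ((Units.coeHom ℂ).comp (zpowersHom _ v))

/-- `Hom(0, n) ⊗_{TL_0} ℂ`, where the non-contractible loop acts on `ℂ` as `u`. For even `n` this is
the link pattern module `V_n(u)`. -/
noncomputable abbrev V0 (q : ℂˣ) (u : ℂ) (n : ℕ) : Type :=
  Balanced (TL q n) (CharModule (Polynomial.aeval u : ℂ[X] →ₐ[ℂ] ℂ))
    (fun (a : ℂ[X]) (f : pt q 0 ⟶ pt q n) => (ofPoly q a : pt q 0 ⟶ pt q 0) ≫ f)

/-- `Hom(1, n) ⊗_{TL_1} ℂ`, where the Dehn twist acts on `ℂ` as `v`. For odd `n` this is the link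
pattern module `V_n(v)`. -/
noncomputable abbrev V1 (q : ℂˣ) (v : ℂˣ) (n : ℕ) : Type :=
  Balanced (TL q n) (CharModule (evalT v))
    (fun (a : ℂ[T;T⁻¹]) (f : pt q 1 ⟶ pt q n) => (ofLaurent q a : pt q 1 ⟶ pt q 1) ≫ f)

end Alg

open Skein

section Pi

variable {q : ℂˣ}

/-- The intertwiner `Ind(M) → M ×_f N`, `Y ⊗ m ↦ Y ⊗ (m ⊗ w)`, for a `TL_n`-module `M` and a
vector `w` of a `TL_1`-module `N`. -/
noncomputable def fusionProj (q : ℂˣ) (n : ℕ) (M N : Type) [AddCommGroup M] [Module ℂ M]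
    [Module (TL q n) M] [IsScalarTower ℂ (TL q n) M] [AddCommGroup N] [Module ℂ N]
    [Module (TL q 1) N] [IsScalarTower ℂ (TL q 1) N] (w : N) :
    Ind (arcInsertion q n) M →ₗ[TL q (n + 1)] Fusion q n 1 M N :=
  Balanced.lift _
    { toFun := fun Y => (Balanced.mkLin (TL q (n + 1)) _ _ Y) ∘ₗ
        ExtTensor.tmulRight (TL q n) (TL q 1) M w
      map_add' := fun x y => by rw [map_add, LinearMap.add_comp]
      map_smul' := fun b x => by rw [map_smul]; rfl }
    (fun a Y m => by
      have h := Balanced.mk_balanced (B := TL q (n + 1)) (N := TL q (n + 1))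
        (fun (a : TL q n ⊗[ℂ] TL q 1) (b : TL q (n + 1)) => b * fusionHom q n 1 a)
        (a ⊗ₜ 1) Y (ExtTensor.tmul (TL q n) (TL q 1) m w)
      rw [ExtTensor.smul_tmul, one_smul, fusionHom_tmul] at h
      refine Eq.trans ?_ h
      have h1 : (show TL q (n + 1) from idTimes n (1 : TL q 1)) = 1 := idTimes_id n 1
      rw [h1, mul_one]
      rfl)

theorem fusionProj_mk (n : ℕ) (M N : Type) [AddCommGroup M] [Module ℂ M]
    [Module (TL q n) M] [IsScalarTower ℂ (TL q n) M] [AddCommGroup N] [Module ℂ N]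
    [Module (TL q 1) N] [IsScalarTower ℂ (TL q 1) N] (w : N) (Y : TL q (n + 1)) (m : M) :
    fusionProj q n M N w (Balanced.mk _ _ Y m) =
      Balanced.mk _ _ Y (ExtTensor.tmul (TL q n) (TL q 1) m w) := rfl

end Pi

section Phi

variable {q : ℂˣ}

theorem balance_adjoin {A P : Type*} [Ring A] [Algebra ℂ A] [AddCommGroup P] [Module ℂ P]
    {X Y : Skein q} (j : A →ₐ[ℂ] End X) (χ : A →ₐ[ℂ] ℂ) (F : (X ⟶ Y) →ₗ[ℂ] P) (s : Set A)
    (hs : ∀ a ∈ s, ∀ f : X ⟶ Y, F ((j a : X ⟶ X) ≫ f) = χ a • F f)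
    (hA : Algebra.adjoin ℂ s = ⊤) (a : A) (f : X ⟶ Y) : F ((j a : X ⟶ X) ≫ f) = χ a • F f := by
  have ha : a ∈ Algebra.adjoin ℂ s := hA ▸ Algebra.mem_top
  induction ha using Algebra.adjoin_induction generalizing f with
  | mem a ha => exact hs a ha f
  | algebraMap c =>
    rw [AlgHom.commutes, AlgHom.commutes]
    change F ((c • (1 : End X) : X ⟶ X) ≫ f) = (algebraMap ℂ ℂ c) • F f
    rw [Linear.smul_comp]
    simp [End.one_def]
  | add a b _ _ ha hb =>
    rw [map_add, map_add, Preadditive.add_comp, map_add, ha, hb, add_smul]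
  | mul a b _ _ ha hb =>
    rw [map_mul, map_mul, End.mul_def, Category.assoc, hb, ha, smul_smul, mul_comm]

theorem laurent_adjoin :
    Algebra.adjoin ℂ ({LaurentPolynomial.T 1, LaurentPolynomial.T (-1)} : Set ℂ[T;T⁻¹]) = ⊤ := by
  refine Algebra.eq_top_iff.2 fun p => ?_
  have h1 : (LaurentPolynomial.T 1 : ℂ[T;T⁻¹]) ∈ Algebra.adjoin ℂ ({LaurentPolynomial.T 1,
    LaurentPolynomial.T (-1)} : Set ℂ[T;T⁻¹]) := Algebra.subset_adjoin (by simp)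
  have h2 : (LaurentPolynomial.T (-1) : ℂ[T;T⁻¹]) ∈ Algebra.adjoin ℂ ({LaurentPolynomial.T 1,
    LaurentPolynomial.T (-1)} : Set ℂ[T;T⁻¹]) := Algebra.subset_adjoin (by simp)
  induction p using LaurentPolynomial.induction_on with
  | h_C a => exact Subalgebra.algebraMap_mem _ a
  | h_add hp hq => exact add_mem hp hq
  | h_C_mul_T n a h =>
    rw [LaurentPolynomial.T_add, ← mul_assoc]
    exact mul_mem h h1
  | h_C_mul_T_Z n a h =>
    rw [sub_eq_add_neg, LaurentPolynomial.T_add, ← mul_assoc]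
    exact mul_mem h h2

theorem ofLaurent_T (n : ℤ) : ofLaurent q (LaurentPolynomial.T n) = ((twist q ^ n : (TL q 1)ˣ) : TL q 1) := by
  exact (AddMonoidAlgebra.lift_single _ _ _).trans (one_smul ..)

theorem evalT_T (v : ℂˣ) (n : ℤ) : evalT v (LaurentPolynomial.T n) = ((v ^ n : ℂˣ) : ℂ) := by
  exact (AddMonoidAlgebra.lift_single _ _ _).trans (one_smul ..)

/-- The element `Y ⊗ c` of `Hom(0, n) ⊗_{TL_0} ℂ`. -/
noncomputable def V0.lin (q : ℂˣ) (u : ℂ) (n : ℕ) : (pt q 0 ⟶ pt q n) →ₗ[TL q n] ℂ →ₗ[ℂ] V0 q u n :=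
  Balanced.mkLin (TL q n) (CharModule _) _

/-- The element `Z ⊗ c` of `Hom(1, n) ⊗_{TL_1} ℂ`. -/
noncomputable def V1.lin (q v : ℂˣ) (n : ℕ) : (pt q 1 ⟶ pt q n) →ₗ[TL q n] ℂ →ₗ[ℂ] V1 q v n :=
  Balanced.mkLin (TL q n) (CharModule _) _

theorem V0.lin_loop (u : ℂ) (n : ℕ) (Y : pt q 0 ⟶ pt q n) (c : ℂ) :
    V0.lin q u n (loop q ≫ Y) c = u • V0.lin q u n Y c := by
  have h := Balanced.mk_balanced (B := TL q n) (M := CharModule (Polynomial.aeval u : ℂ[X] →ₐ[ℂ] ℂ))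
    (fun (a : ℂ[X]) (f : pt q 0 ⟶ pt q n) => (ofPoly q a : pt q 0 ⟶ pt q 0) ≫ f)
    Polynomial.X Y c
  have h1 : ofPoly q Polynomial.X = loop q := Polynomial.aeval_X _
  simp only [h1] at h
  refine Eq.trans h ?_
  rw [← map_smul]
  refine congrArg (V0.lin q u n Y) ?_
  change Polynomial.aeval u (Polynomial.X : ℂ[X]) * c = u * c
  rw [Polynomial.aeval_X]

theorem V1.lin_rot (v : ℂˣ) (n : ℕ) (Z : pt q 1 ⟶ pt q n) (c : ℂ) :
    V1.lin q v n (rot one_pos ≫ Z) c = (v : ℂ) • V1.lin q v n Z c := by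
  have h := Balanced.mk_balanced (B := TL q n) (M := CharModule (evalT v))
    (fun (a : ℂ[T;T⁻¹]) (f : pt q 1 ⟶ pt q n) => (ofLaurent q a : pt q 1 ⟶ pt q 1) ≫ f)
    (LaurentPolynomial.T 1) Z c
  have h1 : ofLaurent q (LaurentPolynomial.T 1) = (rot one_pos : pt q 1 ⟶ pt q 1) := by
    rw [ofLaurent_T, zpow_one]; rfl
  simp only [h1] at h
  refine Eq.trans h ?_
  rw [← map_smul]
  refine congrArg (V1.lin q v n Z) ?_
  change evalT v (LaurentPolynomial.T 1) * c = v * c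
  rw [evalT_T, zpow_one]

theorem V1.lin_rotInv (v : ℂˣ) (n : ℕ) (Z : pt q 1 ⟶ pt q n) (c : ℂ) :
    V1.lin q v n (rotInv one_pos ≫ Z) c = ((v⁻¹ : ℂˣ) : ℂ) • V1.lin q v n Z c := by
  have h := V1.lin_rot v n (rotInv one_pos ≫ Z) c
  rw [← Category.assoc, rot_rotInv, Category.id_comp] at h
  rw [h, smul_smul, Units.inv_mul, one_smul]

/-- The parameter `u = q v + q⁻¹ v⁻¹`. -/
noncomputable def loopValue (q v : ℂˣ) : ℂ := (q : ℂ) * v + ((q⁻¹ : ℂˣ) : ℂ) * ((v⁻¹ : ℂˣ) : ℂ)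

theorem insertArc_loop : (insertArc (loop q) : pt q 1 ⟶ pt q 1) =
    (q : ℂ) • rot one_pos + ((q⁻¹ : ℂˣ) : ℂ) • rotInv one_pos := by
  have h1 : (insertArc (loop q) : pt q 1 ⟶ pt q 1) = (cu 0 (by omega) rfl : pt q 1 ⟶ pt q 3) ≫
      (cr true 1 (by omega) ≫ rot (by omega)) ≫ ca 0 (by omega) rfl := by
    rw [loop, insertArc_comp, insertArc_comp, insertArc_rot]
    exact congrArg₂ (· ≫ ·) (insertArc_el ..) (congrArg₂ (· ≫ ·) rfl (insertArc_el ..))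
  have h2 : (cr true 1 (by omega) : pt q 3 ⟶ pt q 3) = (q : ℂ) • 𝟙 _ + ((q⁻¹ : ℂˣ) : ℂ) •
      ((ca 1 (by omega) rfl : pt q 3 ⟶ pt q 1) ≫ cu 1 (by omega) rfl) := over_eq rfl
  have h3 : (cu 0 (by omega) rfl : pt q 1 ⟶ pt q 3) ≫ rot (by omega) =
      rot one_pos ≫ cu 1 le_rfl rfl := el_rot rfl one_pos le_rfl
  have h4 : (cu 1 (by omega) rfl : pt q 1 ⟶ pt q 3) ≫ rot (by omega) ≫ ca 0 (by omega) rfl =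
      rotInv one_pos := by
    have h5 : rot (by omega) ≫ rot (by omega) ≫ (ca 0 (by omega) rfl : pt q 3 ⟶ pt q 1) =
      ca 1 (by omega) rfl := rot_rot_cap
    have h6 : rot one_pos ≫ (cu 1 (by omega) rfl : pt q 1 ⟶ pt q 3) ≫ rot (by omega) ≫
        ca 0 (by omega) rfl = 𝟙 (pt q 1) := by
      rw [← reassoc_of% h3, h5, cu_ca_left rfl]
    rw [← Category.id_comp (cu 1 _ _), ← rotInv_rot one_pos, Category.assoc, Category.assoc, h6,
      Category.comp_id]
  rw [h1, h2]
  simp only [Preadditive.add_comp, Preadditive.comp_add, Linear.smul_comp, Linear.comp_smul,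
    Category.id_comp, Category.assoc]
  rw [reassoc_of% h3, cu_ca_right rfl, reassoc_of% cu_ca_left (q := q) (i := 0) (j := 1) rfl, h4,
    Category.comp_id]

/-- `U = q c₊ + v c₋ : 0 → 2`, where `c₊` is the cup and `c₋` its rotation by one step. -/
noncomputable def twistedCup (q v : ℂˣ) : pt q 0 ⟶ pt q 2 :=
  (q : ℂ) • cu 0 le_rfl rfl + (v : ℂ) • (cu 0 le_rfl rfl ≫ rot two_pos)

theorem twistedCup_ins_rot (v : ℂˣ) : twistedCup q v ≫ insertArc (rot one_pos) =
    (v : ℂ) • twistedCup q v + (((q⁻¹ : ℂˣ) : ℂ) * v) •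
      ((loop q - loopValue q v • 𝟙 _) ≫ cu 0 le_rfl rfl ≫ rot two_pos) := by
  have h1 : (insertArc (rot one_pos) : pt q 2 ⟶ pt q 2) = cr true 0 le_rfl ≫ rot two_pos := insertArc_rot _
  have h2 : (cr true 0 le_rfl : pt q 2 ⟶ pt q 2) = (q : ℂ) • 𝟙 _ + ((q⁻¹ : ℂˣ) : ℂ) •
      ((ca 0 le_rfl rfl : pt q 2 ⟶ pt q 0) ≫ cu 0 le_rfl rfl) := over_eq rfl
  have h3 : (cu 0 le_rfl rfl : pt q 0 ⟶ pt q 2) ≫ rot two_pos ≫ rot two_pos =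
      cu 0 le_rfl rfl := cup_rot_rot
  have h4 := cu_ca_loop (q := q) (i := 0) (m := 0) (n := 2) le_rfl rfl le_rfl rfl
  have h5 : loop q = (cu 0 le_rfl rfl : pt q 0 ⟶ pt q 2) ≫ rot two_pos ≫ ca 0 le_rfl rfl := rfl
  have hq : (q : ℂ) * ((q⁻¹ : ℂˣ) : ℂ) = 1 := by simp
  have hv : (v : ℂ) * ((v⁻¹ : ℂˣ) : ℂ) = 1 := by simp
  rw [h1, h2, h5, twistedCup, loopValue]
  generalize ((q⁻¹ : ℂˣ) : ℂ) = p at *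
  generalize ((v⁻¹ : ℂˣ) : ℂ) = w at *
  generalize (q : ℂ) = q at *
  generalize (v : ℂ) = v at *
  simp only [Preadditive.add_comp, Preadditive.comp_add, Linear.smul_comp, Linear.comp_smul,
    Category.id_comp, Category.assoc, Preadditive.sub_comp, smul_add, smul_sub,
    smul_smul, h3, reassoc_of% h4]
  match_scalars
  · linear_combination (v ^ 2 - p ^ 2 - q ^ 2) * hq + p ^ 2 * hv
  · ring
  · ring

theorem even_balance (v : ℂˣ) (n : ℕ) (a : ℂ[X]) (Y : pt q 0 ⟶ pt q n) (c : ℂ) :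
    V1.lin q v (n + 1) (insertArc ((ofPoly q a : pt q 0 ⟶ pt q 0) ≫ Y)) c =
      V1.lin q v (n + 1) (insertArc Y) (Polynomial.aeval (loopValue q v) a * c) := by
  have h := balance_adjoin (ofPoly q) (Polynomial.aeval (loopValue q v))
    (((V1.lin q v (n + 1)).restrictScalars ℂ) ∘ₗ insertArc) {Polynomial.X} (by
      rintro _ rfl f
      refine LinearMap.ext fun c => ?_
      have h1 : ofPoly q Polynomial.X = loop q := Polynomial.aeval_X _
      have h2 : insertArc (loop q ≫ f) = (q : ℂ) • (rot one_pos ≫ insertArc f) +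
          ((q⁻¹ : ℂˣ) : ℂ) • (rotInv one_pos ≫ insertArc f) := by
        rw [insertArc_comp, insertArc_loop, Preadditive.add_comp, Linear.smul_comp, Linear.smul_comp]
      have h3 := map_add ((V1.lin q v (n + 1)).restrictScalars ℂ)
        ((q : ℂ) • (rot one_pos ≫ insertArc f)) (((q⁻¹ : ℂˣ) : ℂ) • (rotInv one_pos ≫ insertArc f))
      rw [map_smul, map_smul] at h3
      rw [h1, Polynomial.aeval_X, LinearMap.comp_apply, h2, h3]
      change (q : ℂ) • V1.lin q v (n + 1) (rot one_pos ≫ insertArc f) c +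
        ((q⁻¹ : ℂˣ) : ℂ) • V1.lin q v (n + 1) (rotInv one_pos ≫ insertArc f) c =
        loopValue q v • V1.lin q v (n + 1) (insertArc f) c
      rw [V1.lin_rot, V1.lin_rotInv, loopValue, add_smul, mul_smul, mul_smul])
    Polynomial.adjoin_X a Y
  refine (LinearMap.congr_fun h c).trans ?_
  exact ((V1.lin q v (n + 1) (insertArc Y)).map_smul _ _).symm

theorem odd_balance_rot (v : ℂˣ) (n : ℕ) (f : pt q 1 ⟶ pt q n) (c : ℂ) :
    V0.lin q (loopValue q v) (n + 1) (twistedCup q v ≫ insertArc (rot one_pos ≫ f)) c =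
      (v : ℂ) • V0.lin q (loopValue q v) (n + 1) (twistedCup q v ≫ insertArc f) c := by
  have h2 : twistedCup q v ≫ insertArc (rot one_pos ≫ f) = (v : ℂ) • (twistedCup q v ≫ insertArc f) +
      (((q⁻¹ : ℂˣ) : ℂ) * v) • (loop q ≫ (cu 0 le_rfl rfl ≫ rot two_pos) ≫ insertArc f -
        loopValue q v • ((cu 0 le_rfl rfl ≫ rot two_pos) ≫ insertArc f)) := by
    rw [insertArc_comp, ← Category.assoc, twistedCup_ins_rot]
    simp only [Preadditive.add_comp, Preadditive.sub_comp, Linear.smul_comp, Category.assoc,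
      Category.id_comp]
  have h3 := congrArg (fun g => (V0.lin q (loopValue q v) (n + 1)).restrictScalars ℂ g) h2
  simp only [map_add, map_smul, map_sub] at h3
  refine (LinearMap.congr_fun h3 c).trans ?_
  change (v : ℂ) • V0.lin q (loopValue q v) (n + 1) (twistedCup q v ≫ insertArc f) c +
    (((q⁻¹ : ℂˣ) : ℂ) * v) •
    (V0.lin q (loopValue q v) (n + 1) (loop q ≫ (cu 0 le_rfl rfl ≫ rot two_pos) ≫ insertArc f) c -
      loopValue q v • V0.lin q (loopValue q v) (n + 1) ((cu 0 le_rfl rfl ≫ rot two_pos) ≫ insertArc f) c) = _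
  rw [V0.lin_loop, sub_self, smul_zero, add_zero]

theorem odd_balance (v : ℂˣ) (n : ℕ) (a : ℂ[T;T⁻¹]) (Z : pt q 1 ⟶ pt q n) (c : ℂ) :
    V0.lin q (loopValue q v) (n + 1)
        (twistedCup q v ≫ insertArc ((ofLaurent q a : pt q 1 ⟶ pt q 1) ≫ Z)) c =
      V0.lin q (loopValue q v) (n + 1) (twistedCup q v ≫ insertArc Z) (evalT v a * c) := by
  have h := balance_adjoin (ofLaurent q) (evalT v)
    (((V0.lin q (loopValue q v) (n + 1)).restrictScalars ℂ) ∘ₗ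
      (Linear.leftComp ℂ (pt q (n + 1)) (twistedCup q v)) ∘ₗ insertArc)
      {LaurentPolynomial.T 1, LaurentPolynomial.T (-1)} (by
      intro a ha f
      refine LinearMap.ext fun c => ?_
      obtain rfl | rfl := ha
      · rw [ofLaurent_T, evalT_T, zpow_one, zpow_one]
        exact odd_balance_rot v n f c
      · rw [ofLaurent_T, evalT_T, zpow_neg, zpow_neg, zpow_one, zpow_one]
        have h2 := odd_balance_rot v n (rotInv one_pos ≫ f) c
        rw [← Category.assoc (rot _), rot_rotInv, Category.id_comp] at h2
        change V0.lin q (loopValue q v) (n + 1) (twistedCup q v ≫ insertArc (rotInv one_pos ≫ f)) c =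
          ((v⁻¹ : ℂˣ) : ℂ) • V0.lin q (loopValue q v) (n + 1) (twistedCup q v ≫ insertArc f) c
        rw [h2, smul_smul, Units.inv_mul, one_smul]) laurent_adjoin a Z
  refine (LinearMap.congr_fun h c).trans ?_
  exact ((V0.lin q (loopValue q v) (n + 1) (twistedCup q v ≫ insertArc Z)).map_smul _ _).symm

/-- The intertwiner `Y ⊗ 1 ↦ (Y × Id_1) ⊗ 1` from `V_n(u)` to the restriction of `V_{n+1}(v)`. -/
noncomputable def phiEven (q v : ℂˣ) (n : ℕ) :
    V0 q (loopValue q v) n →ₗ[TL q n] Res (arcInsertion q n) (V1 q v (n + 1)) :=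
  Balanced.lift _
    { toFun := fun Y => (V1.lin q v (n + 1) (insertArc Y) : ℂ →ₗ[ℂ] V1 q v (n + 1))
      map_add' := fun x y => by rw [map_add, map_add]; rfl
      map_smul' := fun b Y => by
        have h : insertArc (b • Y) = arcInsertion q n b • insertArc Y := insertArc_comp Y b
        rw [h, map_smul]; rfl }
    (fun a Y c => even_balance v n a Y c)

/-- The intertwiner `Z ⊗ 1 ↦ ((Z × Id_1) ∘ U) ⊗ 1` from `V_n(v)` to the restriction of
`V_{n+1}(u)`. -/
noncomputable def phiOdd (q v : ℂˣ) (n : ℕ) :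
    V1 q v n →ₗ[TL q n] Res (arcInsertion q n) (V0 q (loopValue q v) (n + 1)) :=
  Balanced.lift _
    { toFun := fun Z => (V0.lin q (loopValue q v) (n + 1) (twistedCup q v ≫ insertArc Z) :
        ℂ →ₗ[ℂ] V0 q (loopValue q v) (n + 1))
      map_add' := fun x y => by rw [map_add, Preadditive.comp_add, map_add]; rfl
      map_smul' := fun b Z => by
        have h : twistedCup q v ≫ insertArc (b • Z) = arcInsertion q n b • (twistedCup q v ≫ insertArc Z) :=
          (congrArg (_ ≫ ·) (insertArc_comp Z b)).trans (Category.assoc _ _ _).symm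
        rw [h, map_smul]; rfl }
    (fun a Z c => odd_balance v n a Z c)

theorem phiEven_lin (v : ℂˣ) (n : ℕ) (Y : pt q 0 ⟶ pt q n) (c : ℂ) :
    phiEven q v n (V0.lin q (loopValue q v) n Y c) = V1.lin q v (n + 1) (insertArc Y) c := rfl

theorem phiOdd_lin (v : ℂˣ) (n : ℕ) (Z : pt q 1 ⟶ pt q n) (c : ℂ) :
    phiOdd q v n (V1.lin q v n Z c) =
      V0.lin q (loopValue q v) (n + 1) (twistedCup q v ≫ insertArc Z) c := rfl

/-- The basis vector `Id_1 ⊗ 1` of the one-dimensional module `V_1(v)`. -/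
noncomputable def V1.one (q v : ℂˣ) : V1 q v 1 := V1.lin q v 1 (𝟙 (pt q 1)) 1

end Phi

end AnnularSkein

open AnnularSkein

namespace AnnularSkein

open Skein

/-! The module V_1(w) is generated over TL_1 by the single vector 1_w, and the Dehn twist ρ
multiplies this vector by w. Fusing a TL_n-module M with V_1(w) therefore adds no generators to
Ind(M). In Y ⊗ (m ⊗ Z 1_w) the element Z can be moved through the balancing relation into the
coefficient, which gives Y(Id_n × Z) ⊗ (m ⊗ 1_w). This is the surjectivity of the projections
(`fusionProj_surjective`), and surjectivity gives the uniqueness of the factorizations.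

What the fusion product imposes beyond Ind(M) is that Id_n × ρ acts as w on the vectors 1 ⊗ (m ⊗
1_w). Hence, for an intertwiner φ from M to the restriction of a TL_{n+1}-module P, the induced map
on Ind(M) descends as soon as (Id_n × ρ) φ(m) = w φ(m) for all m. The descended map sends Y ⊗ (m ⊗ Z
1_w) to Y (Id_n × Z) φ(m). It is compatible with TL_n ⊗ TL_1 because Y' × Id_1 and Id_n × Z commute
(`interchange`). This universal property is `existsUnique_comp_fusionProj`. Its proof uses neither
that TL_1 is generated by ρ nor that V_1(w) is one-dimensional.

It remains to find the eigenvalue of the twist of the last strand on the image of the two maps of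
the tower. In the even case the twist slides inwards under Y until it sits on the inner boundary
circle, where it becomes v (`twist_smul_phiEven`). In the odd case it slides inwards under Z until
it meets U. There Id_1 × ρ is the full rotation of two strands followed by ρ⁻¹ × Id_1, and U is
invariant under the full rotation. So a twist of the lower strand of U is an inverse twist of the
upper one; that one is absorbed by Z and gives v⁻¹ (`twist_smul_phiOdd`). This explains why the
second factor is V_1(v) in one case and V_1(v⁻¹) in the other. -/

theorem Balanced.induction {A B N M : Type*} [Ring A] [Ring B] [Algebra ℂ B] [AddCommGroup N]
    [Module ℂ N] [Module B N] [IsScalarTower ℂ B N] [AddCommGroup M] [Module ℂ M] [Module A M]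
    {r : A → N → N} {p : Balanced B M r → Prop} (zero : p 0)
    (mk : ∀ n m, p (Balanced.mk B r n m)) (add : ∀ x y, p x → p y → p (x + y))
    (x : Balanced B M r) : p x := by
  obtain ⟨t, rfl⟩ := Submodule.mkQ_surjective (balancedRel r : Submodule B (N ⊗[ℂ] M)) x
  induction t using TensorProduct.induction_on with
  | zero => rw [map_zero]; exact zero
  | tmul n m => exact mk n m
  | add s t hs ht => rw [map_add]; exact add _ _ hs ht

variable {q : ℂˣ}

/-! ### The generator of V_1(v) -/

section Cyclic

/-- Only bilinearity over ℂ and Z = Z ∘ Id are used: the scalar moves from the second tensor factor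
to the first. The balancing relation, and with it the value v, plays no role here. -/
theorem V1.mk_eq_smul_one (v : ℂˣ) (Z : TL q 1) (c : ℂ) :
    V1.lin q v 1 (show pt q 1 ⟶ pt q 1 from Z) c = (c • Z) • V1.one q v := by
  -- The left action of TL_1 on Hom(1, 1) is composition on the outside, so acting on the identity
  -- gives `𝟙 ≫ _`.
  have h1 : (c • Z) • (𝟙 (pt q 1) : pt q 1 ⟶ pt q 1) = c • (show pt q 1 ⟶ pt q 1 from Z) :=
    Category.id_comp _
  have h2 : (V1.lin q v 1).restrictScalars ℂ (c • (show pt q 1 ⟶ pt q 1 from Z)) =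
      c • V1.lin q v 1 (show pt q 1 ⟶ pt q 1 from Z) := map_smul _ _ _
  have h3 := congrArg (fun f => f (1 : ℂ)) (map_smul (V1.lin q v 1) (c • Z) (𝟙 (pt q 1)))
  rw [h1] at h3
  refine Eq.trans ?_ h3
  refine Eq.trans ?_ (LinearMap.congr_fun h2 (1 : ℂ)).symm
  rw [LinearMap.smul_apply, ← map_smul]
  exact congrArg _ (mul_one c).symm

/-- The `TL_1`-module `V_1(v)` is generated by `1_v`. -/
theorem V1.exists_smul_one (v : ℂˣ) (x : V1 q v 1) : ∃ Z : TL q 1, x = Z • V1.one q v := by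
  induction x using Balanced.induction with
  | zero => exact ⟨0, (zero_smul _ _).symm⟩
  | mk Z c => exact ⟨_, V1.mk_eq_smul_one v Z c⟩
  | add x y hx hy =>
    obtain ⟨Y, rfl⟩ := hx
    obtain ⟨Z, rfl⟩ := hy
    exact ⟨Y + Z, (add_smul ..).symm⟩

end Cyclic

/-! ### Surjectivity of the projection onto the fusion product -/

section Projection

variable {n : ℕ} {M N : Type} [AddCommGroup M] [Module ℂ M] [Module (TL q n) M]
  [IsScalarTower ℂ (TL q n) M] [AddCommGroup N] [Module ℂ N] [Module (TL q 1) N]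
  [IsScalarTower ℂ (TL q 1) N]

/-- This is the balancing relation at 1 ⊗ Z, since `fusionHom` maps 1 ⊗ Z to Id_n × Z. It trades an
operator on the second factor for a right factor of the coefficient, which is what allows the second
factor to be reduced to one fixed generator. -/
theorem Fusion.mk_smul_right (Y : TL q (n + 1)) (m : M) (Z : TL q 1) (w : N) :
    (Balanced.mk (TL q (n + 1)) _ Y (ExtTensor.tmul (TL q n) (TL q 1) m (Z • w)) :
        Fusion q n 1 M N) =
      Balanced.mk (TL q (n + 1)) _ (Y * idTimesAlg q n 1 Z)
        (ExtTensor.tmul (TL q n) (TL q 1) m w) := by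
  have h := Balanced.mk_balanced (B := TL q (n + 1)) (N := TL q (n + 1))
    (fun (a : TL q n ⊗[ℂ] TL q 1) (b : TL q (n + 1)) => b * fusionHom q n 1 a)
    (1 ⊗ₜ Z) Y (ExtTensor.tmul (TL q n) (TL q 1) m w)
  rw [ExtTensor.smul_tmul, one_smul] at h
  refine h.symm.trans ?_
  have h1 : fusionHom q n 1 ((1 : TL q n) ⊗ₜ Z) = idTimesAlg q n 1 Z := by
    refine (fusionHom_tmul n 1 1 Z).trans ?_
    have h2 : (show TL q (n + 1) from timesId 1 (1 : TL q n)) = 1 := timesId_id 1 n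
    rw [h2, one_mul]
    rfl
  simp only [h1]

/-- The projection `Y ⊗ m ↦ Y ⊗ (m ⊗ w)` is surjective if `w` generates the second factor. -/
theorem fusionProj_surjective {w : N} (hw : ∀ x : N, ∃ Z : TL q 1, x = Z • w) :
    Function.Surjective (fusionProj q n M N w) := by
  intro x
  induction x using Balanced.induction with
  | zero => exact ⟨0, map_zero _⟩
  | add x y hx hy =>
    obtain ⟨a, rfl⟩ := hx
    obtain ⟨b, rfl⟩ := hy
    exact ⟨a + b, map_add _ _ _⟩
  | mk Y t =>
    -- The claim is restated for the plain tensor product behind `ExtTensor`, so that induction on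
    -- tensors applies. With `Balanced.mkLin` the class of Y ⊗ t is visibly additive in t for fixed
    -- Y.
    have h : ∀ t : M ⊗[ℂ] N, ∃ a, fusionProj q n M N w a =
        Balanced.mkLin (TL q (n + 1)) (ExtTensor (TL q n) (TL q 1) M N)
          (fun (a : TL q n ⊗[ℂ] TL q 1) (b : TL q (n + 1)) => b * fusionHom q n 1 a) Y t := by
      intro t
      induction t using TensorProduct.induction_on with
      | zero => exact ⟨0, (map_zero _).trans (map_zero _).symm⟩
      | add s t hs ht =>
        obtain ⟨a, ha⟩ := hs
        obtain ⟨b, hb⟩ := ht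
        exact ⟨a + b, (map_add _ _ _).trans ((congrArg₂ (· + ·) ha hb).trans (map_add _ _ _).symm)⟩
      | tmul m x =>
        obtain ⟨Z, rfl⟩ := hw x
        -- A preimage of Y ⊗ (m ⊗ Zw) is Y(Id_n × Z) ⊗ m.
        exact ⟨Balanced.mk _ _ (Y * idTimesAlg q n 1 Z) m, (Fusion.mk_smul_right Y m Z w).symm⟩
    exact h t

end Projection

/-! ### The universal property of the fusion product with V_1(v) -/

section Factorization

variable {n : ℕ} {v : ℂˣ} {M P : Type} [AddCommGroup M] [Module ℂ M] [Module (TL q n) M]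
  [IsScalarTower ℂ (TL q n) M] [AddCommGroup P] [Module ℂ P] [Module (TL q (n + 1)) P]
  [IsScalarTower ℂ (TL q (n + 1)) P]

/-- On an eigenvector of the Dehn twist `ρ` with eigenvalue `v`, the Laurent polynomials in `ρ` act
through the character `ρ ↦ v`. -/
theorem idTimes_ofLaurent_smul {x : P}
    (hx : idTimesAlg q n 1 (twist q : TL q 1) • x = (v : ℂ) • x) (a : ℂ[T;T⁻¹]) :
    idTimesAlg q n 1 (ofLaurent q a) • x = evalT v a • x := by
  have ha : a ∈ Algebra.adjoin ℂ
    ({LaurentPolynomial.T 1, LaurentPolynomial.T (-1)} : Set ℂ[T;T⁻¹]) :=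
      laurent_adjoin ▸ Algebra.mem_top
  induction ha using Algebra.adjoin_induction with
  | mem a ha =>
    obtain rfl | rfl := ha
    · rw [ofLaurent_T, evalT_T, zpow_one, zpow_one, hx]
    · rw [ofLaurent_T, evalT_T, zpow_neg, zpow_neg, zpow_one, zpow_one]
      -- For ρ⁻¹ the eigenvalue equation is solved for x, that is x = v⁻¹ (Id × ρ) x; then Id × ρ⁻¹
      -- cancels Id × ρ and leaves v⁻¹ x.
      have h : x = ((v⁻¹ : ℂˣ) : ℂ) • idTimesAlg q n 1 (twist q : TL q 1) • x := by
        rw [hx, smul_smul, Units.inv_mul, one_smul]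
      conv_lhs => rw [h]
      rw [smul_comm, smul_smul, ← map_mul, Units.inv_mul, map_one, one_smul]
  | algebraMap c => rw [AlgHom.commutes, AlgHom.commutes, AlgHom.commutes, algebraMap_smul]; rfl
  | add a b _ _ ha hb => simp only [map_add, add_smul, ha, hb]
  | mul a b _ _ ha hb =>
    rw [map_mul, map_mul, map_mul, mul_smul, hb, smul_comm, ha, smul_smul, mul_comm]

/-- The intertwiner `Z_v ↦ (Id × Z) x` on `V_1(v)` for an eigenvector `x` of the Dehn twist. -/
noncomputable def evalAt (x : P)
    (hx : idTimesAlg q n 1 (twist q : TL q 1) • x = (v : ℂ) • x) :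
    V1 q v 1 →ₗ[TL q 1] Res (idTimesAlg q n 1) P :=
  Balanced.lift _
    -- The second tensor factor is the character module, a copy of ℂ, so Z ⊗ c has to go to c (Id ×
    -- Z) x.
    { toFun := fun Z => (LinearMap.toSpanSingleton ℂ P (idTimesAlg q n 1 Z • x) :
        ℂ →ₗ[ℂ] P)
      map_add' := fun Y Z => by
        rw [map_add, add_smul]
        exact LinearMap.ext fun c => smul_add _ _ _
      map_smul' := fun Y Z => by
        rw [smul_eq_mul, map_mul, mul_smul]
        exact LinearMap.ext fun c => smul_comm _ _ _ }
    -- Composition with a Laurent polynomial in ρ on the inside is right multiplication, `Z *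
    -- ofLaurent q a`. Hence the polynomial reaches x before Z does, and it is enough that x itself
    -- is an eigenvector; commutativity of TL_1 is not needed.
    (fun a (Z : TL q 1) (c : ℂ) => by
      change c • idTimesAlg q n 1 (Z * ofLaurent q a) • x =
        (evalT v a * c) • idTimesAlg q n 1 Z • x
      rw [map_mul, mul_smul, idTimes_ofLaurent_smul hx, smul_comm _ (evalT v a), smul_smul,
        mul_comm])

/-- The linear map underlying `evalAt`. -/
noncomputable def evalLin (x : P)
    (hx : idTimesAlg q n 1 (twist q : TL q 1) • x = (v : ℂ) • x) : V1 q v 1 →ₗ[ℂ] P :=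
  resLin (idTimesAlg q n 1) (evalAt x hx)

/-- The vector 1_v is the class of Id_1 ⊗ 1 and goes to x; the rest is equivariance. As 1_v
generates V_1(v), this formula determines the map and serves as its working description below. -/
theorem evalLin_smul_one (x : P) (hx : idTimesAlg q n 1 (twist q : TL q 1) • x = (v : ℂ) • x)
    (Z : TL q 1) : evalLin x hx (Z • V1.one q v) = idTimesAlg q n 1 Z • x := by
  refine (resLin_smul _ _ Z _).trans (congrArg _ ?_)
  change (1 : ℂ) • idTimesAlg q n 1 1 • x = x
  rw [map_one, one_smul, one_smul]

omit [Module ℂ P] [IsScalarTower ℂ (TL q (n + 1)) P] in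
-- This is the interchange law for Y on top of the last strand and Z on that strand, read in a
-- module; `arcInsertion` is Y ↦ Y × Id_1.
theorem timesId_idTimes_smul_comm (Y : TL q n) (Z : TL q 1) (x : P) :
    arcInsertion q n Y • idTimesAlg q n 1 Z • x = idTimesAlg q n 1 Z • arcInsertion q n Y • x := by
  have h : arcInsertion q n Y * idTimesAlg q n 1 Z = idTimesAlg q n 1 Z * arcInsertion q n Y :=
    interchange (m := 1) (n := 1) (k := n) (l := n) Z Y
  rw [smul_smul, smul_smul, h]

variable (φ : M →ₗ[TL q n] Res (arcInsertion q n) P)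
  (hφ : ∀ m, idTimesAlg q n 1 (twist q : TL q 1) • resLin (arcInsertion q n) φ m =
    (v : ℂ) • resLin (arcInsertion q n) φ m)

/-- The linear map `m ⊗ Z_v ↦ (Id × Z) φ(m)`. -/
noncomputable def pairing : M ⊗[ℂ] V1 q v 1 →ₗ[ℂ] P :=
  TensorProduct.lift
    (LinearMap.mk₂ ℂ (fun m z => evalLin (resLin (arcInsertion q n) φ m) (hφ m) z)
      -- Linearity in m is not formal, because `evalLin` is constructed separately for each
      -- eigenvector φ(m). It is checked on z = Z 1_v, where the value (Id × Z) φ(m) is linear in m.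
      (fun m m' z => by
        obtain ⟨Z, rfl⟩ := V1.exists_smul_one v z
        rw [evalLin_smul_one, evalLin_smul_one, evalLin_smul_one, map_add, smul_add])
      (fun c m z => by
        obtain ⟨Z, rfl⟩ := V1.exists_smul_one v z
        rw [evalLin_smul_one, evalLin_smul_one, map_smul, smul_comm])
      (fun m y z => map_add _ y z)
      (fun c m z => map_smul _ c z))

theorem pairing_tmul (m : M) (Z : TL q 1) :
    pairing φ hφ (m ⊗ₜ (Z • V1.one q v)) =
      idTimesAlg q n 1 Z • resLin (arcInsertion q n) φ m :=
  evalLin_smul_one _ (hφ m) Z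

/-- On pure tensors, (Y ⊗ Z)(m ⊗ W 1_v) is sent to (Id × ZW)(Y × Id) φ(m), because φ is an
intertwiner. The interchange law turns this into (Y × Id)(Id × Z)(Id × W) φ(m), and (Y × Id)(Id × Z)
is Y × Z. This equivariance is exactly the balancing condition for a map on the fusion product. -/
theorem pairing_smul (a : TL q n ⊗[ℂ] TL q 1) (x : M ⊗[ℂ] V1 q v 1) :
    pairing φ hφ (extAct (TL q n) (TL q 1) M (V1 q v 1) a x) =
      fusionHom q n 1 a • pairing φ hφ x := by
  induction a using TensorProduct.induction_on with
  | zero => simp only [map_zero, LinearMap.zero_apply, zero_smul]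
  | add a b ha hb => simp only [map_add, LinearMap.add_apply, add_smul, ha, hb]
  | tmul Y Z =>
    induction x using TensorProduct.induction_on with
    | zero => simp only [map_zero, smul_zero]
    | add s t hs ht => simp only [map_add, smul_add, hs, ht]
    | tmul m z =>
      obtain ⟨W, rfl⟩ := V1.exists_smul_one v z
      have h : pairing φ hφ ((Y • m) ⊗ₜ[ℂ] ((Z * W) • V1.one q v)) =
          (arcInsertion q n Y * idTimesAlg q n 1 Z) • pairing φ hφ (m ⊗ₜ (W • V1.one q v)) := by
        -- The interchange law is used twice, to move Y × Id past Id × Z and then past Id × W.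
        rw [pairing_tmul, pairing_tmul, resLin_smul, map_mul, mul_smul, mul_smul,
          timesId_idTimes_smul_comm, timesId_idTimes_smul_comm]
      rw [mul_smul Z W] at h
      exact h

/-- The intertwiner `Y ⊗ (m ⊗ Z_v) ↦ Y (Id × Z) φ(m)` on the fusion product with `V_1(v)`. -/
noncomputable def fusionLift : Fusion q n 1 M (V1 q v 1) →ₗ[TL q (n + 1)] P :=
  Balanced.lift _
    { toFun := fun Y => (Y • pairing φ hφ : M ⊗[ℂ] V1 q v 1 →ₗ[ℂ] P)
      map_add' := fun x y => add_smul x y _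
      map_smul' := fun x y => mul_smul x y _ }
    (fun a Y x => by
      change (Y * fusionHom q n 1 a) • pairing φ hφ x =
        Y • pairing φ hφ (extAct (TL q n) (TL q 1) M (V1 q v 1) a x)
      exact (mul_smul ..).trans (congrArg (Y • ·) (pairing_smul φ hφ a x).symm))

/-- The projection inserts 1_v itself, so on Y ⊗ m the factor Id × Z occurs with Z = 1 and only Y
φ(m) remains. -/
theorem fusionLift_comp_fusionProj :
    fusionLift φ hφ ∘ₗ fusionProj q n M (V1 q v 1) (V1.one q v) =
      inducedMap (arcInsertion q n) φ := by
  refine LinearMap.ext fun x => ?_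
  induction x using Balanced.induction with
  | zero => simp only [map_zero]
  | add x y hx hy => simp only [map_add, hx, hy]
  | mk Y m =>
    have h := pairing_tmul φ hφ m 1
    rw [one_smul, map_one, one_smul] at h
    exact congrArg (Y • ·) h

/-- The universal property of the fusion product with `V_1(v)`: an intertwiner whose values are
eigenvectors of the Dehn twist of the last strand factors uniquely. -/
theorem existsUnique_comp_fusionProj (φ : M →ₗ[TL q n] Res (arcInsertion q n) P)
    (hφ : ∀ m, idTimesAlg q n 1 (twist q : TL q 1) • resLin (arcInsertion q n) φ m =
      (v : ℂ) • resLin (arcInsertion q n) φ m) :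
    ∃! ψ : Fusion q n 1 M (V1 q v 1) →ₗ[TL q (n + 1)] P,
      ψ ∘ₗ fusionProj q n M (V1 q v 1) (V1.one q v) = inducedMap (arcInsertion q n) φ := by
  refine ⟨fusionLift φ hφ, fusionLift_comp_fusionProj φ hφ, fun ψ hψ => ?_⟩
  -- Uniqueness needs only the surjectivity of the projection; the eigenvalue condition enters
  -- through existence.
  refine (LinearMap.cancel_right (fusionProj_surjective (V1.exists_smul_one v))).1 ?_
  exact hψ.trans (fusionLift_comp_fusionProj φ hφ).symm

end Factorization

/-! ### The twist of the last strand on the images of the tower maps -/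

section Eigenvectors

/-- With no strands in front there is nothing to cross, so the chain of crossings in `idTimes_rot`
is empty. -/
theorem idTimes_zero_rot : (idTimes 0 (rot one_pos) : pt q (0 + 1) ⟶ pt q (0 + 1)) =
    (rot one_pos : pt q 1 ⟶ pt q 1) :=
  (idTimes_rot 0 one_pos).trans (Category.comp_id _)

/-- The inserted strand lies below Y, so its twist can be performed before Y instead of after it.
There it is a composition with ρ on the inside, which the tensor product over TL_1 turns into v. -/
theorem twist_smul_phiEven (v : ℂˣ) (n : ℕ) (m : V0 q (loopValue q v) n) :
    idTimesAlg q n 1 (twist q : TL q 1) • resLin (arcInsertion q n) (phiEven q v n) m =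
      (v : ℂ) • resLin (arcInsertion q n) (phiEven q v n) m := by
  induction m using Balanced.induction with
  | zero => simp only [map_zero, smul_zero]
  | add x y hx hy => simp only [map_add, smul_add, hx, hy]
  | mk Y c =>
    have h : (insertArc Y : pt q 1 ⟶ pt q (n + 1)) ≫ idTimes n (rot one_pos) =
        rot one_pos ≫ insertArc Y := by
      -- Since Y starts at the object 0, the inner side of the interchange law carries Id_0 × ρ,
      -- which is ρ itself.
      have h1 := interchange (m := 1) (n := 1) (rot one_pos) Y
      rw [idTimes_zero_rot] at h1
      exact h1.symm
    change V1.lin q v (n + 1) ((insertArc Y : pt q 1 ⟶ pt q (n + 1)) ≫ idTimes n (rot one_pos))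
      (c : ℂ) = (v : ℂ) • V1.lin q v (n + 1) (insertArc Y) (c : ℂ)
    rw [h]
    exact V1.lin_rot v (n + 1) (insertArc Y) c

/-- The full rotation of two points fixes c₊, hence also its rotation c₋. The coefficients q and v
are irrelevant: every combination of the two cups is invariant. -/
theorem twistedCup_rot_rot (v : ℂˣ) :
    twistedCup q v ≫ rot two_pos ≫ rot two_pos = twistedCup q v := by
  have h : (cu 0 le_rfl rfl : pt q 0 ⟶ pt q 2) ≫ rot two_pos ≫ rot two_pos =
      cu 0 le_rfl rfl := cup_rot_rot
  simp only [twistedCup, Preadditive.add_comp, Linear.smul_comp, Category.assoc]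
  rw [reassoc_of% h, h]

/-- `Id_1 × ρ` is the full rotation of two strands, composed with `ρ⁻¹ × Id_1`. -/
theorem idTimes_one_rot : (idTimes 1 (rot one_pos) : pt q 2 ⟶ pt q 2) =
    rot two_pos ≫ rot two_pos ≫ insertArc (rotInv one_pos) := by
  have h1 : (idTimes 1 (rot one_pos) : pt q 2 ⟶ pt q 2) = rot two_pos ≫ cr false 0 le_rfl :=
    (idTimes_rot 1 one_pos).trans (congrArg (_ ≫ ·) (Category.id_comp _))
  -- The crossing sits at position 1 - 1 = 0 and is of the same type as the one in Id_1 × ρ. The two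
  -- diagrams thus differ only in `rot` against `rotInv`, which is a full rotation of two points.
  have h2 : (insertArc (rotInv one_pos) : pt q 2 ⟶ pt q 2) = rotInv two_pos ≫ cr false 0 le_rfl :=
    insertArc_rotInv _
  rw [h1, h2, reassoc_of% rot_rotInv (q := q) two_pos]

/-- U absorbs the full rotation, so twisting its lower strand amounts to untwisting its upper
strand. This is the source of the inverse in V_1(v⁻¹), and it holds in the skein category itself,
before the loop is set equal to u. -/
theorem twistedCup_idTimes_rot (v : ℂˣ) : twistedCup q v ≫ idTimes 1 (rot one_pos) =
    twistedCup q v ≫ insertArc (rotInv one_pos) := by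
  have h := congrArg (· ≫ insertArc (rotInv one_pos)) (twistedCup_rot_rot (q := q) v)
  simp only [Category.assoc] at h
  rw [idTimes_one_rot, h]

/-- This is `odd_balance_rot` applied to ρ⁻¹ followed by f. Here the relation X = u is needed: in
Hom(0, 2) the vector U is an eigenvector of ρ × Id_1 only up to a multiple of X - u
(`twistedCup_ins_rot`). -/
theorem odd_balance_rotInv (v : ℂˣ) (n : ℕ) (f : pt q 1 ⟶ pt q n) (c : ℂ) :
    V0.lin q (loopValue q v) (n + 1) (twistedCup q v ≫ insertArc (rotInv one_pos ≫ f)) c =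
      ((v⁻¹ : ℂˣ) : ℂ) •
        V0.lin q (loopValue q v) (n + 1) (twistedCup q v ≫ insertArc f) c := by
  have h := odd_balance_rot v n (rotInv one_pos ≫ f) c
  rw [← Category.assoc (rot _), rot_rotInv, Category.id_comp] at h
  rw [h, smul_smul, Units.inv_mul, one_smul]

/-- The twist slides inwards past Z × Id_1 to U, reappears there as ρ⁻¹ × Id_1 on the other strand,
and is merged with Z into (Z ∘ ρ⁻¹) × Id_1. The class of ((Z ∘ ρ⁻¹) × Id_1) ∘ U is v⁻¹ times that of
(Z × Id_1) ∘ U. -/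
theorem twist_smul_phiOdd (v : ℂˣ) (n : ℕ) (m : V1 q v n) :
    idTimesAlg q n 1 (twist q : TL q 1) • resLin (arcInsertion q n) (phiOdd q v n) m =
      ((v⁻¹ : ℂˣ) : ℂ) • resLin (arcInsertion q n) (phiOdd q v n) m := by
  induction m using Balanced.induction with
  | zero => simp only [map_zero, smul_zero]
  | add x y hx hy => simp only [map_add, smul_add, hx, hy]
  | mk Z c =>
    have h : (twistedCup q v ≫ insertArc Z) ≫ idTimes n (rot one_pos) =
        twistedCup q v ≫ insertArc (rotInv one_pos ≫ Z) := by
      have h1 : idTimes 1 (rot one_pos) ≫ insertArc Z = insertArc Z ≫ idTimes n (rot one_pos) :=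
        interchange (m := 1) (n := 1) (rot one_pos) Z
      rw [Category.assoc, ← h1, ← Category.assoc, twistedCup_idTimes_rot, Category.assoc,
        insertArc_comp]
    change V0.lin q (loopValue q v) (n + 1)
      ((twistedCup q v ≫ insertArc Z) ≫ idTimes n (rot one_pos)) (c : ℂ) =
      ((v⁻¹ : ℂˣ) : ℂ) • V0.lin q (loopValue q v) (n + 1) (twistedCup q v ≫ insertArc Z) (c : ℂ)
    rw [h]
    exact odd_balance_rotInv v n Z c

end Eigenvectors

end AnnularSkein

/-- The eigenvalue statements hold for every n; parity only selects the n for which the modules are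
the link pattern modules. In the odd half the universal property is applied with v⁻¹ in place of v.
-/
theorem mainTheorem4 (q v : ℂˣ) (k : ℕ) :
    (Function.Surjective
        (fusionProj q (2 * k) (V0 q (loopValue q v) (2 * k)) (V1 q v 1) (V1.one q v)) ∧
      ∃! ψ : Fusion q (2 * k) 1 (V0 q (loopValue q v) (2 * k)) (V1 q v 1) →ₗ[TL q (2 * k + 1)]
          V1 q v (2 * k + 1),
        ψ ∘ₗ fusionProj q (2 * k) (V0 q (loopValue q v) (2 * k)) (V1 q v 1) (V1.one q v) =
          inducedMap (arcInsertion q (2 * k)) (phiEven q v (2 * k))) ∧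
    (Function.Surjective
        (fusionProj q (2 * k + 1) (V1 q v (2 * k + 1)) (V1 q v⁻¹ 1) (V1.one q v⁻¹)) ∧
      ∃! ψ : Fusion q (2 * k + 1) 1 (V1 q v (2 * k + 1)) (V1 q v⁻¹ 1) →ₗ[TL q (2 * k + 2)]
          V0 q (loopValue q v) (2 * k + 2),
        ψ ∘ₗ fusionProj q (2 * k + 1) (V1 q v (2 * k + 1)) (V1 q v⁻¹ 1) (V1.one q v⁻¹) =
          inducedMap (arcInsertion q (2 * k + 1)) (phiOdd q v (2 * k + 1))) :=
  ⟨⟨fusionProj_surjective (V1.exists_smul_one v),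
      existsUnique_comp_fusionProj _ (twist_smul_phiEven v (2 * k))⟩,
    ⟨fusionProj_surjective (V1.exists_smul_one v⁻¹),
      existsUnique_comp_fusionProj _ (twist_smul_phiOdd v (2 * k + 1))⟩⟩
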